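/- Let $\phi:\mathbb{R}\to\mathbb{R}$ be continuous and satisfy the linear envelope condition: there are $c,m\ge 0$ with $|\phi(u)|\le c+m|u|$ for all $u\in\mathbb{R}$. Fix the input dimension $M$, the output dimension $L$, the number $D$ of hidden layers, and variance parameters $\hat C_w^{(\mu)}, C_b^{(\mu)}\ge 0$ for $\mu=1,\dots,D+1$. For each integer $H\ge 1$ consider the random fully connected network whose $D$ hidden layers all have $H$ units: for $x\in\mathbb{R}^M$, $$f^{(1)}_i(x)[H]=\sum_{j=1}^{M}w^{(1)}_{i,j}x_j+b^{(1)}_i,\qquad f^{(\mu+1)}_i(x)[H]=\sum_{j=1}^{H}w^{(\mu+1)}_{i,j}\,\phi\big(f^{(\mu)}_j(x)[H]\big)+b^{(\mu+1)}_i\quad(1\le\mu\le D),$$ where $i$ ranges over $\{1,\dots,H\}$ in the hidden layers and over $\{1,\dots,L\}$ in the output layer $f^{(D+1)}$, and where all weights and biases are independent with $w^{(1)}_{i,j}\sim\mathcal{N}(0,\hat C_w^{(1)})$, $w^{(\mu)}_{i,j}\sim\mathcal{N}(0,\hat C_w^{(\mu)}/H)$ for $\mu\ge 2$, and $b^{(\mu)}_i\sim\mathcal{N}(0,C_b^{(\mu)})$.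 Then for every countable family of inputs $(x[k])_{k\in I}$ in $\mathbb{R}^M$, as $H\to\infty$ (jointly in all hidden layers), the random function $(k,i)\mapsto f^{(D+1)}_i(x[k])[H]$ converges in distribution, as a random element of $\mathbb{R}^{I\times\{1,\dots,L\}}$ with the product topology, to a Gaussian process indexed by $I\times\{1,\dots,L\}$ with mean zero and covariance $$\big((k,i),(k',i')\big)\mapsto\delta_{i,i'}\,K^{(D+1)}(x[k],x[k']),$$ where $$K^{(1)}(x,x')=\hat C_w^{(1)}\sum_{j=1}^{M}x_jx'_j+C_b^{(1)},$$ $$K^{(\mu+1)}(x,x')=\hat C_w^{(\mu+1)}\,\mathbb{E}\big[\phi(\epsilon_1)\phi(\epsilon_2)\big]+C_b^{(\mu+1)},\qquad(\epsilon_1,\epsilon_2)\sim\mathcal{N}\left(0,\begin{pmatrix}K^{(\mu)}(x,x)&K^{(\mu)}(x,x')\\K^{(\mu)}(x',x)&K^{(\mu)}(x',x')\end{pmatrix}\right).$$ -/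

import Mathlib

open MeasureTheory ProbabilityTheory Filter
open scoped NNReal

namespace DeepNet

noncomputable section

/-- The linear envelope property of a nonlinearity. -/
def LinearEnvelope (φ : ℝ → ℝ) : Prop :=
  ∃ c m : ℝ, 0 ≤ c ∧ 0 ≤ m ∧ ∀ u : ℝ, |φ u| ≤ c + m * |u|

/-- Activations (pre-nonlinearities) of a fully connected network. `activation φ h W b x μ i` is
`f⁽μ⁾_i(x)`, for depths `μ = 1, 2, …`: `h μ` is the number of units of hidden layer `μ`, `W μ i j`
and `b μ i` are the weights and biases of layer `μ`. Units are numbered from `0`, and there are no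
activations at depth `0` (the value there is a dummy). For a network with `D` hidden layers the
output is the activation at depth `D + 1`. -/
def activation {M : ℕ} (φ : ℝ → ℝ) (h : ℕ → ℕ) (W : ℕ → ℕ → ℕ → ℝ) (b : ℕ → ℕ → ℝ)
    (x : Fin M → ℝ) : ℕ → ℕ → ℝ
  | 0, _ => 0
  | 1, i => ∑ j : Fin M, W 1 i j * x j + b 1 i
  | μ + 2, i =>
      ∑ j ∈ Finset.range (h (μ + 1)), W (μ + 2) i j * φ (activation φ h W b x (μ + 1) j)
        + b (μ + 2) i

/-- The number of units at depth `μ`, in a network with `M` inputs, `D` hidden layers of sizes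
`h 1, …, h D`, and `L` outputs (depth `D + 1`). -/
def layerWidth (M L D : ℕ) (h : ℕ → ℕ) (μ : ℕ) : ℕ :=
  if μ = 0 then M else if μ ≤ D then h μ else L

/-- The triples `(μ, i, j)` such that the network has a weight `W μ i j`. -/
def weightIndex (M L D : ℕ) (h : ℕ → ℕ) : Set (ℕ × ℕ × ℕ) :=
  {p | 1 ≤ p.1 ∧ p.1 ≤ D + 1 ∧ p.2.1 < layerWidth M L D h p.1 ∧
    p.2.2 < layerWidth M L D h (p.1 - 1)}

/-- The pairs `(μ, i)` such that the network has a bias `b μ i`. -/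
def biasIndex (M L D : ℕ) (h : ℕ → ℕ) : Set (ℕ × ℕ) :=
  {q | 1 ≤ q.1 ∧ q.1 ≤ D + 1 ∧ q.2 < layerWidth M L D h q.1}

/-- The variance of the weights at depth `μ`: it is `Cw 1` at depth `1`, and the fixed
`Cw μ` divided by the number of units of the preceding hidden layer for `μ ≥ 2`. -/
def weightVariance (Cw : ℕ → ℝ≥0) (h : ℕ → ℕ) (μ : ℕ) : ℝ≥0 :=
  if μ = 1 then Cw 1 else Cw μ / (h (μ - 1) : ℝ≥0)

/-- The weights `W` and biases `b` of the network are independent centred normal random variables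
with variances `weightVariance Cw h μ` and `Cb μ` at depth `μ`. Nothing is asked of the entries
of `W` and `b` that do not belong to the network. -/
structure IsRandomNetwork {Ω : Type*} [MeasurableSpace Ω] (P : Measure Ω) (M L D : ℕ) (h : ℕ → ℕ)
    (Cw Cb : ℕ → ℝ≥0) (W : Ω → ℕ → ℕ → ℕ → ℝ) (b : Ω → ℕ → ℕ → ℝ) : Prop where
  weight_law : ∀ p ∈ weightIndex M L D h,
    HasLaw (fun ω => W ω p.1 p.2.1 p.2.2) (gaussianReal 0 (weightVariance Cw h p.1)) P
  bias_law : ∀ q ∈ biasIndex M L D h,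
    HasLaw (fun ω => b ω q.1 q.2) (gaussianReal 0 (Cb q.1)) P
  indep : iIndepFun (β := fun _ => ℝ)
    (Sum.elim (fun (p : weightIndex M L D h) ω => W ω p.1.1 p.1.2.1 p.1.2.2)
      (fun (q : biasIndex M L D h) ω => b ω q.1.1 q.1.2)) P

/-- The covariance recursion: `kernel φ Cw Cb μ x x'` is the limiting covariance of the
activations of one unit at depth `μ = 1, 2, …`, at the inputs `x` and `x'` (dummy value at
depth `0`). -/
def kernel {M : ℕ} (φ : ℝ → ℝ) (Cw Cb : ℕ → ℝ≥0) : ℕ → (Fin M → ℝ) → (Fin M → ℝ) → ℝ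
  | 0, _, _ => 0
  | 1, x, x' => Cw 1 * ∑ j : Fin M, x j * x' j + Cb 1
  | μ + 2, x, x' =>
      Cw (μ + 2) * (∫ ε : EuclideanSpace ℝ (Fin 2), φ (ε 0) * φ (ε 1)
        ∂(multivariateGaussian 0
          !![kernel φ Cw Cb (μ + 1) x x, kernel φ Cw Cb (μ + 1) x x';
             kernel φ Cw Cb (μ + 1) x' x, kernel φ Cw Cb (μ + 1) x' x'])) + Cb (μ + 2)

end

end DeepNet

/-! Given the layers up to depth `μ`, the activations at depth `μ + 1` are affine in fresh Gaussian
parameters. They are therefore exactly jointly Gaussian, independent across units, with a covariance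
`condCov` that is a Gram form of the incoming features. The earlier layers matter only through this
covariance, so the core is a law of large numbers: `condCov` tends in probability to the
deterministic `kernel` (`tendstoProb_condCov`).

This goes by induction on depth. Since the weights have variance `Cw / H`, the next `condCov` is, up
to constants, an average over `H` units that are i.i.d. given the earlier layers. Chebyshev's
inequality puts it near a Gaussian integral with the current covariance, and continuity of such
integrals in the covariance (`continuousOn_integral_multivariateGaussian`) moves this to the
integral defining `kernel`. The linear envelope supplies the polynomial growth behind all moment
bounds.

Conditioning is Fubini after resampling one layer (`integral_infinitePi_update`). It turns the
characteristic function of finitely many outputs into the mean of `exp (-q / 2)`, where `q` is a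
quadratic form built from `condCov` (`charFun_act`), and this converges. Lévy's theorem and
approximation by finitely many coordinates give weak convergence on the countable product
(`tendsto_of_tendsto_charFun_restrict`). The limit process is built by Gram–Schmidt
(`exists_gaussianProcess`), its covariance inheriting positivity from `condCov`. As only laws
matter, `hasLaw_output` moves everything to a canonical parameter space. -/

namespace DeepNet

/-! ### Linear combinations of independent Gaussians -/

section LinearCombinations

variable {T Ω : Type*} {mΩ : MeasurableSpace Ω} {P : Measure Ω}

/-- The linear combination `∑ t ∈ p.1, p.2 t * X t` of the random variables `X`. -/
def linComb (X : T → Ω → ℝ) (p : Finset T × (T → ℝ)) (ω : Ω) : ℝ := ∑ t ∈ p.1, p.2 t * X t ω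

variable {X : T → Ω → ℝ} {v : T → ℝ≥0}

lemma memLp_two_of_hasLaw (hlaw : ∀ t, HasLaw (X t) (gaussianReal 0 (v t)) P) (t : T) :
    MemLp (X t) 2 P := (hlaw t).hasGaussianLaw.memLp_two

lemma isGaussianProcess_of_iIndepFun (hX : iIndepFun X P)
    (hlaw : ∀ t, HasLaw (X t) (gaussianReal 0 (v t)) P) : IsGaussianProcess X P where
  hasGaussianLaw I :=
    iIndepFun.hasGaussianLaw (fun i : I ↦ (hlaw i).hasGaussianLaw)
      (hX.precomp Subtype.val_injective)

/-- Indexing by all finite combinations at once lets one process serve both the affine functionals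
of a layer and the Gram–Schmidt expansions of the limit. -/
lemma isGaussianProcess_linComb (hX : iIndepFun X P)
    (hlaw : ∀ t, HasLaw (X t) (gaussianReal 0 (v t)) P) : IsGaussianProcess (linComb X) P := by
  refine IsGaussianProcess.of_isGaussianProcess (isGaussianProcess_of_iIndepFun hX hlaw) fun p ↦
    ⟨p.1, ∑ t : p.1, p.2 t • ContinuousLinearMap.proj t, fun ω ↦ ?_⟩
  simp [linComb, ← Finset.sum_coe_sort p.1]

lemma integral_linComb (hlaw : ∀ t, HasLaw (X t) (gaussianReal 0 (v t)) P)
    (p : Finset T × (T → ℝ)) : ∫ ω, linComb X p ω ∂P = 0 := by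
  unfold linComb
  have hi (t : T) : Integrable (X t) P := (hlaw t).hasGaussianLaw.integrable
  rw [integral_finsetSum _ fun t _ ↦ (hi t).const_mul _]
  refine Finset.sum_eq_zero fun t _ ↦ ?_
  rw [integral_const_mul, (hlaw t).integral_eq]
  simp

lemma covariance_linComb [IsProbabilityMeasure P] [DecidableEq T] (hX : iIndepFun X P)
    (hlaw : ∀ t, HasLaw (X t) (gaussianReal 0 (v t)) P) (p q : Finset T × (T → ℝ)) :
    cov[linComb X p, linComb X q; P] = ∑ t ∈ p.1 ∩ q.1, p.2 t * q.2 t * v t := by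
  have hm := memLp_two_of_hasLaw hlaw
  have hcov (s t : T) : cov[X s, X t; P] = if s = t then (v t : ℝ) else 0 := by
    split_ifs with h
    · subst h
      rw [covariance_self (hm s).aemeasurable, (hlaw s).variance_eq]
      simp
    · exact (hX.indepFun h).covariance_eq_zero (hm s) (hm t)
  unfold linComb
  rw [covariance_fun_sum_fun_sum' (fun s _ ↦ (hm s).const_mul _) (fun t _ ↦ (hm t).const_mul _)]
  simp_rw [covariance_const_mul_left, covariance_const_mul_right, hcov]
  rw [← Finset.sum_filter_add_sum_filter_not p.1 (· ∈ q.1), Finset.filter_mem_eq_inter]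
  rw [Finset.sum_congr rfl (g := fun t ↦ p.2 t * q.2 t * v t),
    Finset.sum_eq_zero (s := p.1.filter _), add_zero]
  · intro s hs
    refine Finset.sum_eq_zero fun t ht ↦ ?_
    rw [if_neg]
    · simp
    · rintro rfl
      exact (Finset.mem_filter.1 hs).2 ht
  · intro s hs
    rw [Finset.sum_eq_single s]
    · simp; ring
    · intro t _ hts; simp [hts.symm]
    · intro h; exact absurd (Finset.mem_inter.1 hs).2 h

end LinearCombinations

/-! ### Finite-dimensional laws of centred Gaussian processes -/

section Law

variable {T Ω J : Type*} {mΩ : MeasurableSpace Ω} {P : Measure Ω} {X : T → Ω → ℝ} [Fintype J]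

lemma hasGaussianLaw_toLp (hX : IsGaussianProcess X P) (q : J → T) :
    HasGaussianLaw (fun ω ↦ WithLp.toLp 2 (fun j ↦ X (q j) ω)) P := by
  classical
  have h := (hX.comp_right q).hasGaussianLaw Finset.univ
  let L : ({j // j ∈ (Finset.univ : Finset J)} → ℝ) →L[ℝ] EuclideanSpace ℝ J :=
    (EuclideanSpace.equiv J ℝ).symm.toContinuousLinearMap ∘L
      ContinuousLinearMap.pi fun j ↦
        ContinuousLinearMap.proj (⟨j, Finset.mem_univ j⟩ : {j // j ∈ (Finset.univ : Finset J)})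
  exact h.map L

lemma charFun_map_gaussianProcess (hX : IsGaussianProcess X P) (hmean : ∀ t, ∫ ω, X t ω ∂P = 0)
    (q : J → T) (u : EuclideanSpace ℝ J) :
    charFun (P.map fun ω ↦ WithLp.toLp 2 (fun j ↦ X (q j) ω)) u =
      Complex.exp (-(∑ j, ∑ k, u j * u k * cov[X (q j), X (q k); P] : ℝ) / 2) := by
  have := hX.isProbabilityMeasure
  have hm (t : T) : MemLp (X t) 2 P := (hX.hasGaussianLaw_eval t).memLp_two
  rw [(hasGaussianLaw_toLp hX q).charFun_map_eq]
  have h1 : (fun ω ↦ inner ℝ u (WithLp.toLp 2 (fun j ↦ X (q j) ω))) =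
      fun ω ↦ ∑ j, u j * X (q j) ω := by
    ext ω; simp [PiLp.inner_apply, mul_comm]
  rw [h1, integral_finsetSum _ fun j _ ↦ ((hm (q j)).integrable one_le_two).const_mul _,
    ← covariance_self (Finset.aemeasurable_fun_sum _ fun j _ ↦ (hm (q j)).aemeasurable.const_mul _),
    covariance_fun_sum_fun_sum (fun j ↦ (hm (q j)).const_mul _)
      (fun j ↦ (hm (q j)).const_mul _)]
  simp_rw [integral_const_mul, hmean, covariance_const_mul_left, covariance_const_mul_right]
  simp [mul_assoc, neg_div]

lemma posSemidef_covariance (hX : IsGaussianProcess X P) (q : J → T) :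
    (Matrix.of fun j k ↦ cov[X (q j), X (q k); P]).PosSemidef := by
  have := hX.isProbabilityMeasure
  have hm (t : T) : MemLp (X t) 2 P := (hX.hasGaussianLaw_eval t).memLp_two
  refine Matrix.PosSemidef.of_dotProduct_mulVec_nonneg ?_ fun u ↦ ?_
  · ext j k; simp [covariance_comm]
  · have : star u ⬝ᵥ (Matrix.of fun j k ↦ cov[X (q j), X (q k); P]).mulVec u =
        Var[fun ω ↦ ∑ j, u j * X (q j) ω; P] := by
      rw [← covariance_self
          (Finset.aemeasurable_fun_sum _ fun j _ ↦ (hm (q j)).aemeasurable.const_mul _),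
        covariance_fun_sum_fun_sum (fun j ↦ (hm (q j)).const_mul _)
          (fun j ↦ (hm (q j)).const_mul _)]
      simp_rw [covariance_const_mul_left, covariance_const_mul_right]
      simp [dotProduct, Matrix.mulVec, Finset.mul_sum, mul_comm]
    rw [this]
    exact variance_nonneg _ _

/-- Both sides have the same characteristic function. This is the bridge from expectations over a
layer to the integrals in `kernel`. -/
lemma map_gaussianProcess_eq_multivariateGaussian [DecidableEq J] (hX : IsGaussianProcess X P)
    (hmean : ∀ t, ∫ ω, X t ω ∂P = 0) (q : J → T) :
    P.map (fun ω ↦ WithLp.toLp 2 (fun j ↦ X (q j) ω)) =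
      multivariateGaussian 0 (Matrix.of fun j k ↦ cov[X (q j), X (q k); P]) := by
  have := hX.isProbabilityMeasure
  have := (hasGaussianLaw_toLp hX q).isGaussian_map
  refine Measure.ext_of_charFun (funext fun u ↦ ?_)
  rw [charFun_map_gaussianProcess hX hmean, charFun_multivariateGaussian
    (posSemidef_covariance hX q)]
  congr 1
  simp [dotProduct, Matrix.mulVec, Finset.mul_sum, neg_div, mul_assoc,
    mul_comm (Complex.ofReal cov[_, _; P])]

end Law

/-! ### One layer with frozen inputs -/

noncomputable section

/-- The parameters of a layer: unit `i` has bias `l i 0` and weights `l i 1, l i 2, …`. The biases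
have variance `c`, the weights variance `w`. -/
def layerLaw (w c : ℝ≥0) : Measure (ℕ → ℕ → ℝ) :=
  Measure.infinitePi fun _ ↦ Measure.infinitePi fun j ↦ gaussianReal 0 (if j = 0 then c else w)

instance (w c : ℝ≥0) : IsProbabilityMeasure (layerLaw w c) := by
  unfold layerLaw; infer_instance

/-- The affine functional with bias `r 0` and weights `r 1, …, r n`. -/
def affine (n : ℕ) (r : ℕ → ℝ) (a : ℕ → ℝ) : ℝ := ∑ j ∈ Finset.range n, r (j + 1) * a j + r 0

/-- The covariance of the affine functionals of a layer. -/
def gram (w c : ℝ≥0) (n : ℕ) (a a' : ℕ → ℝ) : ℝ := w * ∑ j ∈ Finset.range n, a j * a' j + c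

lemma iIndepFun_layerLaw (w c : ℝ≥0) :
    iIndepFun (fun (p : ℕ × ℕ) (l : ℕ → ℕ → ℝ) ↦ l p.1 p.2) (layerLaw w c) :=
  iIndepFun_uncurry_infinitePi' (X := fun _ _ x ↦ x)
    (fun _ j ↦ gaussianReal 0 (if j = 0 then c else w)) (fun _ _ ↦ measurable_id)

lemma hasLaw_layerLaw (w c : ℝ≥0) (p : ℕ × ℕ) :
    HasLaw (fun l : ℕ → ℕ → ℝ ↦ l p.1 p.2) (gaussianReal 0 (if p.2 = 0 then c else w))
      (layerLaw w c) := by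
  have h1 := measurePreserving_eval_infinitePi
    (fun _ : ℕ ↦ Measure.infinitePi fun j : ℕ ↦ gaussianReal 0 (if j = 0 then c else w)) p.1
  have h2 := measurePreserving_eval_infinitePi
    (fun j : ℕ ↦ gaussianReal 0 (if j = 0 then c else w)) p.2
  exact ⟨(h2.comp h1).measurable.aemeasurable, (h2.comp h1).map_eq⟩

/-- The coefficients of `affine n (l i) a` as a linear combination of the parameters. -/
def affineCoeff (n : ℕ) (q : ℕ × (ℕ → ℝ)) : Finset (ℕ × ℕ) × (ℕ × ℕ → ℝ) :=
  ({q.1} ×ˢ Finset.range (n + 1), fun t ↦ if t.2 = 0 then 1 else q.2 (t.2 - 1))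

lemma affine_eq_linComb (n : ℕ) (q : ℕ × (ℕ → ℝ)) (l : ℕ → ℕ → ℝ) :
    affine n (l q.1) q.2 = linComb (fun (p : ℕ × ℕ) (l : ℕ → ℕ → ℝ) ↦ l p.1 p.2)
      (affineCoeff n q) l := by
  simp [affine, linComb, affineCoeff, Finset.sum_range_succ', mul_comm]

lemma isGaussianProcess_affine (w c : ℝ≥0) (n : ℕ) :
    IsGaussianProcess (fun (q : ℕ × (ℕ → ℝ)) (l : ℕ → ℕ → ℝ) ↦ affine n (l q.1) q.2)
      (layerLaw w c) := by
  simp_rw [affine_eq_linComb]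
  exact (isGaussianProcess_linComb (iIndepFun_layerLaw w c) (hasLaw_layerLaw w c)).comp_right _

lemma integral_affine (w c : ℝ≥0) (n i : ℕ) (a : ℕ → ℝ) :
    ∫ l, affine n (l i) a ∂layerLaw w c = 0 := by
  simp_rw [affine_eq_linComb n (i, a)]
  exact integral_linComb (hasLaw_layerLaw w c) _

lemma covariance_affine (w c : ℝ≥0) (n : ℕ) (q q' : ℕ × (ℕ → ℝ)) :
    cov[fun l ↦ affine n (l q.1) q.2, fun l ↦ affine n (l q'.1) q'.2; layerLaw w c] =
      if q.1 = q'.1 then gram w c n q.2 q'.2 else 0 := by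
  simp_rw [affine_eq_linComb]
  rw [covariance_linComb (iIndepFun_layerLaw w c) (hasLaw_layerLaw w c)]
  split_ifs with h
  · simp only [affineCoeff, h, Finset.inter_self, Finset.sum_product, Finset.sum_singleton,
      Finset.sum_range_succ', gram, Finset.mul_sum]
    simp only [Nat.add_eq_zero_iff, one_ne_zero, and_false, if_false, Nat.add_sub_cancel, if_true]
    simp [mul_comm]
  · rw [affineCoeff, affineCoeff, Finset.product_inter_product,
      Finset.singleton_inter_of_notMem (by simpa using h)]
    simp

/-- The covariance matrix of two affine functionals of the same unit. -/
def gramMatrix (w c : ℝ≥0) (n : ℕ) (a a' : ℕ → ℝ) : Matrix (Fin 2) (Fin 2) ℝ :=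
  !![gram w c n a a, gram w c n a a'; gram w c n a' a, gram w c n a' a']

lemma gramMatrix_eq_covariance (w c : ℝ≥0) (n i : ℕ) (a a' : ℕ → ℝ) :
    gramMatrix w c n a a' = Matrix.of fun j k : Fin 2 ↦
      cov[fun l ↦ affine n (l i) (![a, a'] j), fun l ↦ affine n (l i) (![a, a'] k);
        layerLaw w c] := by
  ext j k
  have h := covariance_affine w c n (i, ![a, a'] j) (i, ![a, a'] k)
  simp only [if_true] at h
  rw [Matrix.of_apply, h]
  fin_cases j <;> fin_cases k <;> simp [gramMatrix]

lemma posSemidef_gramMatrix (w c : ℝ≥0) (n : ℕ) (a a' : ℕ → ℝ) :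
    (gramMatrix w c n a a').PosSemidef := by
  rw [gramMatrix_eq_covariance w c n 0]
  exact posSemidef_covariance (isGaussianProcess_affine w c n) fun j : Fin 2 ↦ (0, ![a, a'] j)

lemma map_affine_pair (w c : ℝ≥0) (n i : ℕ) (a a' : ℕ → ℝ) :
    (layerLaw w c).map (fun l ↦ !₂[affine n (l i) a, affine n (l i) a']) =
      multivariateGaussian 0 (gramMatrix w c n a a') := by
  rw [gramMatrix_eq_covariance w c n i]
  rw [← map_gaussianProcess_eq_multivariateGaussian (isGaussianProcess_affine w c n)
    (fun q ↦ integral_affine w c n q.1 q.2) fun j : Fin 2 ↦ (i, ![a, a'] j)]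
  congr 1
  ext l j
  fin_cases j <;> simp

end

/-! ### Continuity of Gaussian integrals in the covariance matrix -/

section Continuity

open Matrix Topology
open scoped MatrixOrder Matrix.Norms.L2Operator

variable {J : Type*} [Fintype J] [DecidableEq J]

lemma continuousOn_sqrt_posSemidef :
    ContinuousOn (fun S : Matrix J J ℝ ↦ CFC.sqrt S) {S | S.PosSemidef} := by
  have h := CFC.continuousOn_sqrt (A := Matrix J J ℝ)
  simpa only [Matrix.nonneg_iff_posSemidef] using h

lemma integrable_norm_pow_gaussian {E : Type*} [NormedAddCommGroup E] [NormedSpace ℝ E]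
    [MeasurableSpace E] [BorelSpace E] [CompleteSpace E] [SecondCountableTopology E]
    (μ : Measure E) [IsGaussian μ] (k : ℕ) : Integrable (fun z ↦ ‖z‖ ^ k) μ := by
  have h := (IsGaussian.memLp_id μ k (by simp)).integrable_norm_pow'
  simpa using h

lemma integrable_of_growth {E : Type*} [NormedAddCommGroup E] [NormedSpace ℝ E]
    [MeasurableSpace E] [BorelSpace E] [CompleteSpace E] [SecondCountableTopology E]
    (μ : Measure E) [IsGaussian μ] {g : E → ℝ} (hg : Continuous g) {C : ℝ} {k : ℕ}
    (hb : ∀ z, |g z| ≤ C * (1 + ‖z‖ ^ k)) : Integrable g μ :=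
  Integrable.mono' (((integrable_const 1).add (integrable_norm_pow_gaussian μ k)).const_mul C)
    hg.aestronglyMeasurable (.of_forall hb)

/-- Writing the Gaussian vector as `√S z` with `z` standard moves `S` into the integrand. The square
root is continuous on positive semidefinite matrices, and near `S` its norm is at most `‖√S‖ + 1`,
so polynomial growth gives an integrable dominating function. -/
lemma continuousOn_integral_multivariateGaussian {g : EuclideanSpace ℝ J → ℝ} (hg : Continuous g)
    {C : ℝ} {k : ℕ} (hb : ∀ z, |g z| ≤ C * (1 + ‖z‖ ^ k)) :
    ContinuousOn (fun S : Matrix J J ℝ ↦ ∫ z, g z ∂multivariateGaussian 0 S)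
      {S | S.PosSemidef} := by
  have hC : 0 ≤ C := by
    have := (abs_nonneg _).trans (hb 0)
    exact nonneg_of_mul_nonneg_left this (by positivity)
  have hrep (S : Matrix J J ℝ) : ∫ z, g z ∂multivariateGaussian 0 S =
      ∫ z, g (toEuclideanCLM (𝕜 := ℝ) (CFC.sqrt S) z)
        ∂stdGaussian (EuclideanSpace ℝ J) := by
    rw [multivariateGaussian, integral_map (by fun_prop) hg.aestronglyMeasurable]
    simp
  simp_rw [hrep]
  intro S hS
  have hs := continuousOn_sqrt_posSemidef S hS
  have hnorm : Tendsto (fun S : Matrix J J ℝ ↦ ‖CFC.sqrt S‖) (𝓝[{S | S.PosSemidef}] S)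
      (𝓝 ‖CFC.sqrt S‖) := hs.norm
  have hev : ∀ᶠ S' in 𝓝[{S | S.PosSemidef}] S, ‖CFC.sqrt S'‖ ≤ ‖CFC.sqrt S‖ + 1 :=
    (hnorm.eventually_lt_const (lt_add_one _)).mono fun _ ↦ le_of_lt
  refine tendsto_integral_filter_of_dominated_convergence
    (fun z ↦ C * (1 + (‖CFC.sqrt S‖ + 1) ^ k * ‖z‖ ^ k)) ?_ ?_ ?_ ?_
  · exact .of_forall fun S' ↦ (hg.comp (ContinuousLinearMap.continuous _)).aestronglyMeasurable
  · filter_upwards [hev] with S' hS'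
    refine .of_forall fun z ↦ (hb _).trans ?_
    rw [← mul_pow]
    gcongr
    refine (ContinuousLinearMap.le_opNorm _ _).trans ?_
    gcongr
    exact hS'
  · exact ((integrable_const 1).add ((integrable_norm_pow_gaussian _ k).const_mul _)).const_mul C
  · refine .of_forall fun z ↦ (hg.tendsto _).comp ?_
    have hcont : Continuous fun A : Matrix J J ℝ ↦ toEuclideanCLM (𝕜 := ℝ) A z := by
      have : (fun A : Matrix J J ℝ ↦ toEuclideanCLM (𝕜 := ℝ) A z) =
        fun A ↦ WithLp.toLp 2 (A.mulVec z) := by ext A; simp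
      rw [this]
      fun_prop
    exact (hcont.tendsto _).comp hs

end Continuity

section Elementwise

open scoped Matrix.Norms.Elementwise

variable {J : Type*} [Fintype J]

/-- The sup norm on entries, unlike the operator norm used for the square root, reads entrywise
bounds directly as a distance. -/
lemma exists_forall_entries_lt {F : Matrix J J ℝ → ℝ} {s : Set (Matrix J J ℝ)}
    (hF : ContinuousOn F s) {K : Matrix J J ℝ} (hK : K ∈ s) {ε : ℝ} (hε : 0 < ε) :
    ∃ δ > 0, ∀ A ∈ s, (∀ i j, |A i j - K i j| < δ) → |F A - F K| < ε := by
  obtain ⟨δ, hδ, h⟩ := Metric.continuousWithinAt_iff.1 (hF K hK) ε hε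
  refine ⟨δ, hδ, fun A hA hAK ↦ ?_⟩
  have := h hA (by rw [dist_eq_norm, Matrix.norm_lt_iff hδ]; simpa using hAK)
  rwa [Real.dist_eq] at this

end Elementwise

/-! ### Convergence in probability under varying measures -/

section ConvergenceInProbability

variable {Θ : Type*} [MeasurableSpace Θ]

/-- Convergence in probability to a constant of random variables on varying probability spaces. -/
def TendstoProb (ν : ℕ → Measure Θ) (X : ℕ → Θ → ℝ) (c : ℝ) : Prop :=
  ∀ ε > 0, Tendsto (fun H ↦ (ν H).real {θ | ε ≤ |X H θ - c|}) atTop (nhds 0)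

/-- Where every `X j` is `δ`-close to its limit, `G` is small; elsewhere `G ≤ B`, and a union bound
makes that event negligible. `G` may depend on `H` and on all of `θ`, as the conditional
probabilities in `tendstoProb_condCov` require. -/
lemma tendsto_integral_of_tendstoProb {J : Type*} [Fintype J] {ν : ℕ → Measure Θ}
    [∀ H, IsProbabilityMeasure (ν H)] {X : J → ℕ → Θ → ℝ} {c : J → ℝ}
    (hXm : ∀ j H, Measurable (X j H)) (hX : ∀ j, TendstoProb ν (X j) (c j))
    {G : ℕ → Θ → ℝ} {B : ℝ} (hGm : ∀ H, Measurable (G H)) (hG0 : ∀ H θ, 0 ≤ G H θ)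
    (hGB : ∀ H θ, G H θ ≤ B)
    (hG : ∀ ε > 0, ∃ δ > 0, ∀ᶠ H in atTop, ∀ θ, (∀ j, |X j H θ - c j| < δ) → G H θ ≤ ε) :
    Tendsto (fun H ↦ ∫ θ, G H θ ∂ν H) atTop (nhds 0) := by
  rw [Metric.tendsto_nhds]
  intro ε hε
  obtain ⟨δ, hδ, hev⟩ := hG (ε / 2) (by positivity)
  have hlim : Tendsto (fun H ↦ ε / 2 + ∑ j, B * (ν H).real {θ | δ ≤ |X j H θ - c j|}) atTop
      (nhds (ε / 2 + ∑ j : J, B * 0)) :=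
    tendsto_const_nhds.add (tendsto_finsetSum _ fun j _ ↦ (hX j δ hδ).const_mul B)
  have hlt : ε / 2 + ∑ j : J, B * 0 < ε := by simp [hε]
  filter_upwards [hev, hlim.eventually_lt_const hlt] with H hH hH'
  have hms (j : J) : MeasurableSet {θ | δ ≤ |X j H θ - c j|} :=
    measurableSet_le measurable_const ((hXm j H).sub_const _).abs
  have hint : Integrable (G H) (ν H) :=
    Integrable.of_bound (hGm H).aestronglyMeasurable B
      (.of_forall fun θ ↦ by rw [Real.norm_of_nonneg (hG0 H θ)]; exact hGB H θ)
  have hB (θ : Θ) : 0 ≤ B := (hG0 H θ).trans (hGB H θ)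
  have hle : ∫ θ, G H θ ∂ν H ≤
      ∫ θ, (ε / 2 + ∑ j, B * {θ | δ ≤ |X j H θ - c j|}.indicator 1 θ) ∂ν H := by
    refine integral_mono hint ?_ fun θ ↦ ?_
    · refine (integrable_const _).add (integrable_finsetSum _ fun j _ ↦ Integrable.const_mul ?_ _)
      exact (integrable_const (1 : ℝ)).indicator (hms j)
    · have hnn (j : J) : 0 ≤ B * {θ | δ ≤ |X j H θ - c j|}.indicator (1 : Θ → ℝ) θ :=
        mul_nonneg (hB θ) (Set.indicator_nonneg (fun _ _ ↦ zero_le_one) θ)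
      by_cases h : ∀ j, |X j H θ - c j| < δ
      · exact (hH θ h).trans (le_add_of_nonneg_right (Finset.sum_nonneg fun j _ ↦ hnn j))
      · push Not at h
        obtain ⟨j, hj⟩ := h
        have h1 : B * {θ | δ ≤ |X j H θ - c j|}.indicator (1 : Θ → ℝ) θ = B := by
          rw [Set.indicator_of_mem (by exact hj)]; simp
        have h2 := Finset.single_le_sum (fun j _ ↦ hnn j) (Finset.mem_univ j)
        rw [h1] at h2
        linarith [hGB H θ]
  have heq : ∫ θ, (ε / 2 + ∑ j, B * {θ | δ ≤ |X j H θ - c j|}.indicator 1 θ) ∂ν H =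
      ε / 2 + ∑ j, B * (ν H).real {θ | δ ≤ |X j H θ - c j|} := by
    have hi (j : J) : Integrable
        (fun θ ↦ B * {θ | δ ≤ |X j H θ - c j|}.indicator (1 : Θ → ℝ) θ) (ν H) :=
      ((integrable_const (1 : ℝ)).indicator (hms j)).const_mul _
    rw [integral_add (integrable_const _) (integrable_finsetSum _ fun j _ ↦ hi j),
      integral_finsetSum _ fun j _ ↦ hi j]
    simp [integral_const_mul, integral_indicator_one (hms _)]
  rw [dist_zero_right, Real.norm_of_nonneg (integral_nonneg (hG0 H))]
  linarith

end ConvergenceInProbability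

/-! ### Chebyshev's inequality for averages -/

section Averages

variable {Ω : Type*} {mΩ : MeasurableSpace Ω} {P : Measure Ω}

/-- Chebyshev's inequality for the average of independent random variables. -/
lemma measureReal_average_sub_le [IsProbabilityMeasure P] {X : ℕ → Ω → ℝ} (hX : iIndepFun X P)
    (hL2 : ∀ i, MemLp (X i) 2 P) {m s : ℝ} (hm : ∀ i, ∫ ω, X i ω ∂P = m)
    (hs : ∀ i, ∫ ω, X i ω ^ 2 ∂P = s) {H : ℕ} (hH : 0 < H) {η : ℝ} (hη : 0 < η) :
    P.real {ω | η ≤ |(∑ i ∈ Finset.range H, X i ω) / H - m|} ≤ s / (H * η ^ 2) := by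
  have hH' : (0 : ℝ) < H := by exact_mod_cast hH
  have hsum : MemLp (fun ω ↦ (∑ i ∈ Finset.range H, X i ω) / H) 2 P := by
    simp_rw [div_eq_mul_inv]
    exact (memLp_finsetSum _ fun i _ ↦ hL2 i).mul_const _
  have hmean : ∫ ω, (∑ i ∈ Finset.range H, X i ω) / H ∂P = m := by
    rw [integral_div, integral_finsetSum _ fun i _ ↦ (hL2 i).integrable one_le_two]
    simp [hm]; field_simp
  have hvar : Var[fun ω ↦ (∑ i ∈ Finset.range H, X i ω) / H; P] ≤ s / H := by
    have h1 : Var[fun ω ↦ (∑ i ∈ Finset.range H, X i ω) / H; P] =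
        (∑ i ∈ Finset.range H, Var[X i; P]) / H ^ 2 := by
      simp_rw [div_eq_inv_mul]
      rw [variance_const_mul, ← IndepFun.variance_sum (fun i _ ↦ hL2 i)
        fun i _ j _ hij ↦ hX.indepFun hij]
      rw [inv_pow]
      congr 2
      ext ω; simp
    rw [h1, div_le_div_iff₀ (by positivity) hH']
    have h2 : ∑ i ∈ Finset.range H, Var[X i; P] ≤ ∑ i ∈ Finset.range H, s := by
      refine Finset.sum_le_sum fun i _ ↦ ?_
      rw [variance_eq_sub (hL2 i)]
      have := hs i
      simp only [Pi.pow_apply]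
      nlinarith [sq_nonneg (∫ ω, X i ω ∂P)]
    simp only [Finset.sum_const, Finset.card_range, nsmul_eq_mul] at h2
    nlinarith
  have hch := meas_ge_le_variance_div_sq hsum hη
  rw [hmean] at hch
  rw [measureReal_def]
  refine (ENNReal.toReal_mono ENNReal.ofReal_ne_top hch).trans ?_
  rw [ENNReal.toReal_ofReal (div_nonneg (variance_nonneg _ _) (by positivity)), ← div_div]
  gcongr

end Averages

/-! ### Resampling one coordinate of a product measure -/

section Resampling

variable {I : Type*} [DecidableEq I] {E : I → Type*} [∀ i, MeasurableSpace (E i)]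

lemma measurable_update_prod (m : I) :
    Measurable fun p : (∀ i, E i) × E m ↦ Function.update p.1 m p.2 := by
  refine measurable_pi_lambda _ fun i ↦ ?_
  by_cases h : i = m
  · subst h; simpa using measurable_snd
  · simp only [Function.update_of_ne h]; fun_prop

variable (ν : ∀ i, Measure (E i)) [∀ i, IsProbabilityMeasure (ν i)]

lemma infinitePi_map_update (m : I) :
    ((Measure.infinitePi ν).prod (ν m)).map (fun p ↦ Function.update p.1 m p.2) =
      Measure.infinitePi ν := by
  refine Measure.eq_infinitePi ν fun s t ht ↦ ?_
  rw [Measure.map_apply (measurable_update_prod m)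
    (MeasurableSet.pi s.countable_toSet fun i _ ↦ ht i)]
  have hpre : (fun p : (∀ i, E i) × E m ↦ Function.update p.1 m p.2) ⁻¹' (Set.pi s t) =
      (Set.pi (s.erase m : Finset I) t) ×ˢ (if m ∈ s then t m else Set.univ) := by
    ext p
    simp only [Set.mem_preimage, Set.mem_pi, Set.mem_prod, Finset.mem_coe, Finset.mem_erase]
    constructor
    · intro h
      refine ⟨fun i hi ↦ by simpa [hi.1] using h i hi.2, ?_⟩
      split_ifs with hm
      · simpa using h m hm
      · trivial
    · rintro ⟨h1, h2⟩ i hi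
      by_cases him : i = m
      · subst him; simpa [hi] using h2
      · simpa [him] using h1 i ⟨him, hi⟩
  rw [hpre, Measure.prod_prod, Measure.infinitePi_pi ν fun i _ ↦ ht i]
  split_ifs with hm
  · rw [mul_comm, Finset.mul_prod_erase s (fun i ↦ ν i (t i)) hm]
  · simp [Finset.erase_eq_of_notMem hm]

/-- Replacing coordinate `m` by an independent copy preserves the product law. The inner integral
thus plays the role of the conditional expectation given the other coordinates. -/
lemma integral_infinitePi_update {F : Type*} [NormedAddCommGroup F] [NormedSpace ℝ F] (m : I)
    {f : (∀ i, E i) → F} (hf : Integrable f (Measure.infinitePi ν)) :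
    ∫ θ, f θ ∂Measure.infinitePi ν =
      ∫ θ, ∫ l, f (Function.update θ m l) ∂ν m ∂Measure.infinitePi ν := by
  have hmap := infinitePi_map_update ν m
  have hf' := hf
  rw [← hmap] at hf'
  rw [integral_integral (f := fun θ l ↦ f (Function.update θ m l))
    ((integrable_map_measure hf'.aestronglyMeasurable
      (measurable_update_prod m).aemeasurable).1 hf')]
  conv_lhs => rw [← hmap]
  exact integral_map (measurable_update_prod m).aemeasurable hf'.aestronglyMeasurable

lemma measureReal_infinitePi_update (m : I) {A : Set (∀ i, E i)} (hA : MeasurableSet A) :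
    (Measure.infinitePi ν).real A =
      ∫ θ, (ν m).real {l | Function.update θ m l ∈ A} ∂Measure.infinitePi ν := by
  have hi : Integrable (A.indicator (1 : (∀ i, E i) → ℝ)) (Measure.infinitePi ν) :=
    (integrable_const (1 : ℝ)).indicator hA
  rw [← integral_indicator_one hA, integral_infinitePi_update ν m hi]
  congr with θ
  rw [← integral_indicator_one]
  · rfl
  · exact (measurable_update θ) hA

lemma measurable_measureReal_update (m : I) {A : Set (∀ i, E i)} (hA : MeasurableSet A) :
    Measurable fun θ : ∀ i, E i ↦ (ν m).real {l | Function.update θ m l ∈ A} :=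
  (measurable_measure_prodMk_left (measurable_update_prod m hA)).ennreal_toReal

end Resampling

/-! ### Concentration within one layer -/

noncomputable section

section Step

/-- The product of the nonlinearity at the two coordinates of a point in the plane. -/
def phiProd (φ : ℝ → ℝ) (z : EuclideanSpace ℝ (Fin 2)) : ℝ := φ (z 0) * φ (z 1)

variable {φ : ℝ → ℝ}

lemma continuous_phiProd (hφ : Continuous φ) : Continuous (phiProd φ) := by
  unfold phiProd; fun_prop

lemma LinearEnvelope.exists_abs_le (hφ' : LinearEnvelope φ) :
    ∃ C, 0 ≤ C ∧ ∀ {n : ℕ} (z : EuclideanSpace ℝ (Fin n)) (i : Fin n),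
      |φ (z i)| ≤ C * (1 + ‖z‖) := by
  obtain ⟨c, m, hc, hm, h⟩ := hφ'
  refine ⟨c + m, by positivity, fun z i ↦ (h _).trans ?_⟩
  have hz : |z i| ≤ ‖z‖ := by simpa using PiLp.norm_apply_le z i
  nlinarith [norm_nonneg z, mul_le_mul_of_nonneg_left hz hm, mul_nonneg hc (norm_nonneg z)]

lemma exists_abs_phiProd_le (hφ' : LinearEnvelope φ) :
    ∃ C, ∀ z, |phiProd φ z| ≤ C * (1 + ‖z‖ ^ 2) := by
  obtain ⟨C, hC, h⟩ := hφ'.exists_abs_le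
  refine ⟨2 * C ^ 2, fun z ↦ ?_⟩
  rw [phiProd, abs_mul]
  calc |φ (z 0)| * |φ (z 1)| ≤ (C * (1 + ‖z‖)) * (C * (1 + ‖z‖)) := by
        gcongr <;> exact h z _
    -- The difference of the two sides is `C ^ 2 * (1 - ‖z‖) ^ 2`.
    _ ≤ 2 * C ^ 2 * (1 + ‖z‖ ^ 2) := by nlinarith [mul_nonneg (sq_nonneg C) (sq_nonneg (1 - ‖z‖))]

lemma exists_phiProd_sq_le (hφ' : LinearEnvelope φ) :
    ∃ C, ∀ z, |phiProd φ z ^ 2| ≤ C * (1 + ‖z‖ ^ 4) := by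
  obtain ⟨C, h⟩ := exists_abs_phiProd_le hφ'
  refine ⟨2 * C ^ 2, fun z ↦ ?_⟩
  rw [abs_pow]
  calc |phiProd φ z| ^ 2 ≤ (C * (1 + ‖z‖ ^ 2)) ^ 2 := by gcongr; exact h z
    _ ≤ 2 * C ^ 2 * (1 + ‖z‖ ^ 4) := by
      nlinarith [mul_nonneg (sq_nonneg C) (sq_nonneg (1 - ‖z‖ ^ 2))]

/-- The units are i.i.d. once `a` and `a'` are frozen. The bound sees the frozen features only
through their Gram matrix, which is what makes it uniform over typical earlier layers. -/
lemma measureReal_layer_average_le (hφ : Continuous φ) (hφ' : LinearEnvelope φ) (w c : ℝ≥0)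
    (n : ℕ) (a a' : ℕ → ℝ) {H : ℕ} (hH : 0 < H) {η : ℝ} (hη : 0 < η) :
    (layerLaw w c).real {l | η ≤
      |(∑ i ∈ Finset.range H, φ (affine n (l i) a) * φ (affine n (l i) a')) / H
        - ∫ z, phiProd φ z ∂multivariateGaussian 0 (gramMatrix w c n a a')|} ≤
      (∫ z, phiProd φ z ^ 2 ∂multivariateGaussian 0 (gramMatrix w c n a a')) / (H * η ^ 2) := by
  have hcont := continuous_phiProd hφ
  obtain ⟨C, hC⟩ := exists_phiProd_sq_le hφ'
  have haff (b : ℕ → ℝ) : Measurable fun r : ℕ → ℝ ↦ affine n r b := by unfold affine; fun_prop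
  have hpm (i : ℕ) : Measurable fun l : ℕ → ℕ → ℝ ↦
      !₂[affine n (l i) a, affine n (l i) a'] := by
    refine (WithLp.measurable_toLp 2 _).comp (measurable_pi_lambda _ fun j ↦ ?_)
    fin_cases j
    · exact (haff a).comp (measurable_pi_apply i)
    · exact (haff a').comp (measurable_pi_apply i)
  have hint (i : ℕ) (g : EuclideanSpace ℝ (Fin 2) → ℝ) (hg : Continuous g) :
      ∫ l, g !₂[affine n (l i) a, affine n (l i) a'] ∂layerLaw w c =
        ∫ z, g z ∂multivariateGaussian 0 (gramMatrix w c n a a') := by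
    rw [← map_affine_pair w c n i a a', integral_map (hpm i).aemeasurable hg.aestronglyMeasurable]
  have hrow : Measurable fun r : ℕ → ℝ ↦ φ (affine n r a) * φ (affine n r a') :=
    (hφ.measurable.comp (haff a)).mul (hφ.measurable.comp (haff a'))
  have hind : iIndepFun (fun i (l : ℕ → ℕ → ℝ) ↦ φ (affine n (l i) a) * φ (affine n (l i) a'))
      (layerLaw w c) :=
    iIndepFun_infinitePi (X := fun _ r ↦ φ (affine n r a) * φ (affine n r a')) fun _ ↦ hrow
  refine measureReal_average_sub_le hind (fun i ↦ ?_) (fun i ↦ ?_) (fun i ↦ ?_) hH hη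
  · have hm : Measurable fun l : ℕ → ℕ → ℝ ↦ φ (affine n (l i) a) * φ (affine n (l i) a') :=
      hrow.comp (measurable_pi_apply i)
    rw [memLp_two_iff_integrable_sq hm.aestronglyMeasurable]
    have hi := integrable_of_growth (multivariateGaussian 0 (gramMatrix w c n a a'))
      (hcont.pow 2) hC
    rw [← map_affine_pair w c n i a a'] at hi
    simpa [phiProd, Function.comp_def] using hi.comp_measurable (hpm i)
  · simpa [phiProd] using hint i (phiProd φ) hcont
  · simpa [phiProd] using hint i (fun z ↦ phiProd φ z ^ 2) (hcont.pow 2)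

end Step

/-! ### The canonical network and its conditional covariances -/

section Network

/-- The variance of the weights at depth `μ` in a network of width `H`. -/
abbrev wVar (Cw : ℕ → ℝ≥0) (H μ : ℕ) : ℝ≥0 := weightVariance Cw (fun _ ↦ H) μ

/-- The law of the parameters of a network of width `H`, in all layers and for all units. -/
def netLaw (Cw Cb : ℕ → ℝ≥0) (H : ℕ) : Measure (ℕ → ℕ → ℕ → ℝ) :=
  Measure.infinitePi fun μ ↦ layerLaw (wVar Cw H μ) (Cb μ)

instance (Cw Cb : ℕ → ℝ≥0) (H : ℕ) : IsProbabilityMeasure (netLaw Cw Cb H) := by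
  unfold netLaw; infer_instance

/-- The number of units feeding the layer at depth `μ + 1`. -/
def fanIn (M H : ℕ) : ℕ → ℕ
  | 0 => M
  | _ + 1 => H

variable {M : ℕ} (φ : ℝ → ℝ) (H : ℕ)

/-- The activations of the network of width `H` with parameters `θ`. -/
def act (θ : ℕ → ℕ → ℕ → ℝ) (x : Fin M → ℝ) (μ i : ℕ) : ℝ :=
  activation φ (fun _ ↦ H) (fun μ i j ↦ θ μ i (j + 1)) (fun μ i ↦ θ μ i 0) x μ i

/-- The values that the layer at depth `μ + 1` receives: the inputs, or the nonlinearity applied to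
the activations at depth `μ`. -/
def feat (θ : ℕ → ℕ → ℕ → ℝ) (x : Fin M → ℝ) : ℕ → ℕ → ℝ
  | 0, j => if h : j < M then x ⟨j, h⟩ else 0
  | μ + 1, j => φ (act φ H θ x (μ + 1) j)

lemma act_succ (θ : ℕ → ℕ → ℕ → ℝ) (x : Fin M → ℝ) (μ i : ℕ) :
    act φ H θ x (μ + 1) i = affine (fanIn M H μ) (θ (μ + 1) i) (feat φ H θ x μ) := by
  cases μ with
  | zero =>
    simp only [act, activation, affine, fanIn, feat]
    rw [Finset.sum_range]
    simp
  | succ μ => simp [act, activation, affine, fanIn, feat]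

lemma feat_congr {θ θ' : ℕ → ℕ → ℕ → ℝ} (x : Fin M → ℝ) (μ : ℕ)
    (h : ∀ ν ≤ μ, θ ν = θ' ν) : feat φ H θ x μ = feat φ H θ' x μ := by
  induction μ with
  | zero => rfl
  | succ μ ih =>
    ext j
    simp only [feat, act_succ]
    rw [ih fun ν hν ↦ h ν (hν.trans (Nat.le_succ _)), h _ le_rfl]

lemma feat_update (θ : ℕ → ℕ → ℕ → ℝ) (x : Fin M → ℝ) (μ : ℕ) (l : ℕ → ℕ → ℝ) :
    feat φ H (Function.update θ (μ + 1) l) x μ = feat φ H θ x μ :=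
  feat_congr φ H x μ fun ν hν ↦ Function.update_of_ne (by omega) _ _

/-- The features below do not see layer `μ + 1`, so resampling that layer leaves an affine
functional of fresh parameters with fixed coefficients. -/
lemma act_update (θ : ℕ → ℕ → ℕ → ℝ) (x : Fin M → ℝ) (μ i : ℕ) (l : ℕ → ℕ → ℝ) :
    act φ H (Function.update θ (μ + 1) l) x (μ + 1) i =
      affine (fanIn M H μ) (l i) (feat φ H θ x μ) := by
  rw [act_succ, feat_update, Function.update_self]

variable {φ}

lemma measurable_feat (hφ : Continuous φ) (x : Fin M → ℝ) (μ j : ℕ) :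
    Measurable fun θ ↦ feat φ H θ x μ j := by
  induction μ generalizing j with
  | zero => exact measurable_const
  | succ μ ih =>
    have h : (fun θ ↦ feat φ H θ x (μ + 1) j) = fun θ : ℕ → ℕ → ℕ → ℝ ↦
        φ (affine (fanIn M H μ) (θ (μ + 1) j) (feat φ H θ x μ)) := by
      ext θ; rw [feat, act_succ]
    rw [h]
    refine hφ.measurable.comp ?_
    unfold affine
    refine (Finset.measurable_sum _ fun k _ ↦ Measurable.mul (by fun_prop) (ih k)).add
      (by fun_prop)

lemma measurable_act (hφ : Continuous φ) (x : Fin M → ℝ) (μ i : ℕ) :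
    Measurable fun θ ↦ act φ H θ x (μ + 1) i := by
  simp only [act_succ, affine]
  refine (Finset.measurable_sum _ fun k _ ↦
    Measurable.mul (by fun_prop) (measurable_feat H hφ x μ k)).add (by fun_prop)

variable (φ) (Cw Cb : ℕ → ℝ≥0)

/-- The covariance of the activations at depth `μ + 1` given the earlier layers. -/
def condCov (H : ℕ) (θ : ℕ → ℕ → ℕ → ℝ) (x x' : Fin M → ℝ) (μ : ℕ) : ℝ :=
  gram (wVar Cw H (μ + 1)) (Cb (μ + 1)) (fanIn M H μ) (feat φ H θ x μ) (feat φ H θ x' μ)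

variable {φ}

lemma measurable_condCov (hφ : Continuous φ) (x x' : Fin M → ℝ) (μ : ℕ) :
    Measurable fun θ ↦ condCov φ Cw Cb H θ x x' μ := by
  unfold condCov gram
  refine (Measurable.const_mul ?_ _).add_const _
  exact Finset.measurable_sum _ fun k _ ↦
    (measurable_feat H hφ x μ k).mul (measurable_feat H hφ x' μ k)

lemma condCov_zero (θ : ℕ → ℕ → ℕ → ℝ) (x x' : Fin M → ℝ) :
    condCov φ Cw Cb H θ x x' 0 = kernel φ Cw Cb 1 x x' := by
  simp only [condCov, gram, fanIn, feat, kernel, weightVariance]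
  rw [Finset.sum_range]
  simp

/-- The factor `1 / H` in the weight variance turns the Gram sum into an average over units. -/
lemma condCov_succ_update (θ : ℕ → ℕ → ℕ → ℝ) (l : ℕ → ℕ → ℝ) (x x' : Fin M → ℝ)
    (μ : ℕ) :
    condCov φ Cw Cb H (Function.update θ (μ + 1) l) x x' (μ + 1) =
      Cw (μ + 2) * ((∑ i ∈ Finset.range H,
        φ (affine (fanIn M H μ) (l i) (feat φ H θ x μ)) *
          φ (affine (fanIn M H μ) (l i) (feat φ H θ x' μ))) / H) + Cb (μ + 2) := by
  simp only [condCov, gram, fanIn, feat, act_update]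
  simp [weightVariance]
  ring

lemma sum_condCov_nonneg (θ : ℕ → ℕ → ℕ → ℝ) (μ : ℕ) {J : Type*} [Fintype J]
    (y : J → Fin M → ℝ) (u : J → ℝ) :
    0 ≤ ∑ j, ∑ k, u j * u k * condCov φ Cw Cb H θ (y j) (y k) μ := by
  have hps : (Matrix.of fun j k ↦ condCov φ Cw Cb H θ (y j) (y k) μ).PosSemidef := by
    convert posSemidef_covariance (isGaussianProcess_affine (wVar Cw H (μ + 1)) (Cb (μ + 1))
      (fanIn M H μ)) fun j ↦ (0, feat φ H θ (y j) μ) using 1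
    ext j k
    exact (covariance_affine (wVar Cw H (μ + 1)) (Cb (μ + 1)) (fanIn M H μ)
      (0, feat φ H θ (y j) μ) (0, feat φ H θ (y k) μ)).symm
  have h := hps.dotProduct_mulVec_nonneg u
  refine h.trans_eq ?_
  simp [dotProduct, Matrix.mulVec, Finset.mul_sum, mul_assoc, mul_comm (condCov _ _ _ _ _ _ _ _)]

/-- A limit in probability of the conditional covariances is positive semidefinite. -/
lemma sum_nonneg_of_tendstoProb (hφ : Continuous φ) {μ : ℕ} {J : Type*} [Fintype J]
    {y : J → Fin M → ℝ} {K : J → J → ℝ}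
    (hK : ∀ j k, TendstoProb (netLaw Cw Cb) (fun H θ ↦ condCov φ Cw Cb H θ (y j) (y k) μ) (K j k))
    (u : J → ℝ) : 0 ≤ ∑ j, ∑ k, u j * u k * K j k := by
  by_contra! hneg
  have hcont : Continuous fun A : J × J → ℝ ↦ ∑ j, ∑ k, u j * u k * A (j, k) := by fun_prop
  obtain ⟨δ, hδ, h⟩ := Metric.continuousAt_iff.1
    (hcont.continuousAt (x := fun p ↦ K p.1 p.2)) _ (neg_pos.2 hneg)
  -- For `G = 1` the smallness condition holds vacuously: within `δ` of `K` the form would be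
  -- negative, which never happens. The conclusion is then that `1` tends to `0`.
  have hlim := tendsto_integral_of_tendstoProb (ν := netLaw Cw Cb)
    (X := fun (p : J × J) H θ ↦ condCov φ Cw Cb H θ (y p.1) (y p.2) μ)
    (fun p H ↦ measurable_condCov H Cw Cb hφ _ _ _) (fun p ↦ hK p.1 p.2)
    (G := fun _ _ ↦ 1) (B := 1) (fun _ ↦ measurable_const) (by simp) (by simp)
    fun ε _ ↦ ⟨δ, hδ, .of_forall fun H θ hθ ↦ by
      exfalso
      have h1 := h (x := fun p ↦ condCov φ Cw Cb H θ (y p.1) (y p.2) μ)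
        (by rw [dist_pi_lt_iff hδ]; simpa [Real.dist_eq] using hθ)
      have h2 := sum_condCov_nonneg H Cw Cb θ μ (φ := φ) y u
      rw [Real.dist_eq] at h1
      have h3 := (le_abs_self _).trans_lt h1
      simp only at h3
      linarith⟩
  simp only [integral_const, probReal_univ, smul_eq_mul, mul_one] at hlim
  exact one_ne_zero (tendsto_nhds_unique tendsto_const_nhds hlim)

end Network

end

/-! ### Conditional covariances converge to the kernel -/

variable {M : ℕ} {φ : ℝ → ℝ} (Cw Cb : ℕ → ℝ≥0)

/-- The matrix of the values of a function of two variables at the pairs formed from `x, x'`. -/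
def pairMatrix {X : Type*} (K : X → X → ℝ) (x x' : X) : Matrix (Fin 2) (Fin 2) ℝ :=
  !![K x x, K x x'; K x' x, K x' x']

lemma pairMatrix_apply {X : Type*} (K : X → X → ℝ) (x x' : X) (j k : Fin 2) :
    pairMatrix K x x' j k = K (![x, x'] j) (![x, x'] k) := by
  fin_cases j <;> fin_cases k <;> rfl

lemma tendstoProb_unique {Θ : Type*} [MeasurableSpace Θ] {ν : ℕ → Measure Θ}
    [∀ H, IsProbabilityMeasure (ν H)] {X : ℕ → Θ → ℝ} (hX : ∀ H, Measurable (X H)) {c c' : ℝ}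
    (h : TendstoProb ν X c) (h' : TendstoProb ν X c') : c = c' := by
  by_contra hne
  have hδ : 0 < |c - c'| / 2 := by have := abs_pos.2 (sub_ne_zero.2 hne); positivity
  have hlim := tendsto_integral_of_tendstoProb (ν := ν) (J := Bool) (X := fun _ ↦ X)
    (c := fun j ↦ if j then c else c') (fun _ ↦ hX) (by simp [h, h'])
    (G := fun _ _ ↦ 1) (B := 1) (fun _ ↦ measurable_const) (by simp) (by simp)
    fun ε _ ↦ ⟨_, hδ, .of_forall fun H θ hθ ↦ by
      exfalso
      have h1 := hθ true
      have h2 := hθ false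
      simp only [if_true, Bool.false_eq_true, if_false] at h1 h2
      have h3 := abs_sub_le c (X H θ) c'
      rw [abs_sub_comm c (X H θ)] at h3
      linarith⟩
  simp only [integral_const, probReal_univ, smul_eq_mul, mul_one] at hlim
  exact one_ne_zero (tendsto_nhds_unique tendsto_const_nhds hlim)

lemma condCov_comm (H : ℕ) (θ : ℕ → ℕ → ℕ → ℝ) (x x' : Fin M → ℝ) (μ : ℕ) :
    condCov φ Cw Cb H θ x x' μ = condCov φ Cw Cb H θ x' x μ := by
  simp [condCov, gram, mul_comm (feat φ H θ x μ _)]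

/-- Symmetry passes to the limit from `condCov`. Convergence at this one depth is a hypothesis so
that the lemma can be used inside the induction proving it. -/
lemma kernel_comm (hφ : Continuous φ) (μ : ℕ) (x x' : Fin M → ℝ)
    (h : ∀ x x' : Fin M → ℝ, TendstoProb (netLaw Cw Cb)
      (fun H θ ↦ condCov φ Cw Cb H θ x x' μ) (kernel φ Cw Cb (μ + 1) x x')) :
    kernel φ Cw Cb (μ + 1) x x' = kernel φ Cw Cb (μ + 1) x' x := by
  refine tendstoProb_unique (fun H ↦ measurable_condCov H Cw Cb hφ x x' μ) (h x x') ?_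
  simpa only [condCov_comm Cw Cb _ _ x x'] using h x' x

lemma posSemidef_pairMatrix_kernel (hφ : Continuous φ) (μ : ℕ)
    (h : ∀ x x' : Fin M → ℝ, TendstoProb (netLaw Cw Cb)
      (fun H θ ↦ condCov φ Cw Cb H θ x x' μ) (kernel φ Cw Cb (μ + 1) x x')) (x x' : Fin M → ℝ) :
    (pairMatrix (kernel φ Cw Cb (μ + 1)) x x').PosSemidef := by
  refine Matrix.PosSemidef.of_dotProduct_mulVec_nonneg ?_ fun u ↦ ?_
  · ext j k
    simp only [Matrix.conjTranspose_apply, pairMatrix_apply, star_trivial]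
    exact kernel_comm Cw Cb hφ μ _ _ h
  · have := sum_nonneg_of_tendstoProb Cw Cb hφ (y := ![x, x'])
      (K := fun j k ↦ kernel φ Cw Cb (μ + 1) (![x, x'] j) (![x, x'] k)) (fun j k ↦ h _ _) u
    refine this.trans_eq ?_
    simp [dotProduct, Matrix.mulVec, pairMatrix, Fin.sum_univ_two]
    ring

/-- At depth one the covariance is deterministic. In the inductive step, the average over units is
compared with `F A`, where `A` is the current conditional covariance (Chebyshev), and `F A` with `F
K` (continuity and the induction hypothesis). -/
lemma tendstoProb_condCov (hφ : Continuous φ) (hφ' : LinearEnvelope φ) (μ : ℕ)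
    (x x' : Fin M → ℝ) : TendstoProb (netLaw Cw Cb) (fun H θ ↦ condCov φ Cw Cb H θ x x' μ)
      (kernel φ Cw Cb (μ + 1) x x') := by
  induction μ generalizing x x' with
  | zero =>
    intro ε hε
    simp [condCov_zero, not_le.2 hε]
  | succ μ ih =>
    intro ε hε
    set K := pairMatrix (kernel φ Cw Cb (μ + 1)) x x' with hKdef
    have hK : K.PosSemidef := posSemidef_pairMatrix_kernel Cw Cb hφ μ ih x x'
    set F := fun S : Matrix (Fin 2) (Fin 2) ℝ ↦ ∫ z, phiProd φ z ∂multivariateGaussian 0 S with hF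
    set F2 := fun S : Matrix (Fin 2) (Fin 2) ℝ ↦
      ∫ z, phiProd φ z ^ 2 ∂multivariateGaussian 0 S with hF2
    have hker : kernel φ Cw Cb (μ + 1 + 1) x x' = Cw (μ + 2) * F K + Cb (μ + 2) := rfl
    obtain ⟨C, hC⟩ := exists_abs_phiProd_le hφ'
    obtain ⟨C', hC'⟩ := exists_phiProd_sq_le hφ'
    have hFc := continuousOn_integral_multivariateGaussian (continuous_phiProd hφ) hC
    have hF2c := continuousOn_integral_multivariateGaussian ((continuous_phiProd hφ).pow 2) hC'
    -- Two errors of size `η` are scaled by `Cw (μ + 2)`; the `+ 1` covers a vanishing variance.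
    set η := ε / (2 * (Cw (μ + 2) + 1)) with hη
    have hCw : (0 : ℝ) ≤ Cw (μ + 2) := NNReal.coe_nonneg _
    have hηpos : 0 < η := by positivity
    have hηε : Cw (μ + 2) * (2 * η) < ε := by
      rw [hη]; field_simp; nlinarith
    obtain ⟨δ₁, hδ₁, h₁⟩ := exists_forall_entries_lt hFc hK hηpos
    -- Only a bound on the second moment is needed, so tolerance `1` suffices: the Chebyshev
    -- numerator is at most `F2 K + 1`.
    obtain ⟨δ₂, hδ₂, h₂⟩ := exists_forall_entries_lt hF2c hK one_pos
    have hset (H : ℕ) : MeasurableSet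
        {θ : ℕ → ℕ → ℕ → ℝ | ε ≤ |condCov φ Cw Cb H θ x x' (μ + 1) -
          kernel φ Cw Cb (μ + 1 + 1) x x'|} :=
      measurableSet_le measurable_const
        ((measurable_condCov H Cw Cb hφ x x' (μ + 1)).sub_const _).abs
    have hreal (H : ℕ) := measureReal_infinitePi_update
      (fun μ ↦ layerLaw (wVar Cw H μ) (Cb μ)) (μ + 1) (hset H)
    have hgoal : (fun H ↦ (netLaw Cw Cb H).real
        {θ | ε ≤ |condCov φ Cw Cb H θ x x' (μ + 1) - kernel φ Cw Cb (μ + 1 + 1) x x'|}) =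
        fun H ↦ ∫ θ, (layerLaw (wVar Cw H (μ + 1)) (Cb (μ + 1))).real
          {l | Function.update θ (μ + 1) l ∈ {θ | ε ≤ |condCov φ Cw Cb H θ x x' (μ + 1) -
            kernel φ Cw Cb (μ + 1 + 1) x x'|}} ∂netLaw Cw Cb H := funext hreal
    rw [hgoal]
    refine tendsto_integral_of_tendstoProb (J := Fin 2 × Fin 2) (B := 1)
      (X := fun p H θ ↦ condCov φ Cw Cb H θ (![x, x'] p.1) (![x, x'] p.2) μ)
      (fun p H ↦ measurable_condCov H Cw Cb hφ _ _ _) (fun p ↦ ih _ _)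
      (fun H ↦ measurable_measureReal_update (fun μ ↦ layerLaw (wVar Cw H μ) (Cb μ)) (μ + 1)
        (hset H))
      (fun _ _ ↦ measureReal_nonneg) (fun _ _ ↦ measureReal_le_one) fun ε' hε' ↦
        ⟨min δ₁ δ₂, lt_min hδ₁ hδ₂, ?_⟩
    have hlim : Tendsto (fun H : ℕ ↦ (F2 K + 1) / (H * η ^ 2)) atTop (nhds 0) := by
      refine tendsto_const_nhds.div_atTop ?_
      exact tendsto_natCast_atTop_atTop.atTop_mul_const (by positivity)
    filter_upwards [eventually_gt_atTop 0, hlim.eventually_le_const hε'] with H hH hH' θ hθ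
    set a := feat φ H θ x μ
    set a' := feat φ H θ x' μ
    set A := gramMatrix (wVar Cw H (μ + 1)) (Cb (μ + 1)) (fanIn M H μ) a a' with hA
    have hApair : A = pairMatrix (fun x x' ↦ condCov φ Cw Cb H θ x x' μ) x x' := rfl
    have hApos : A.PosSemidef := posSemidef_gramMatrix _ _ _ _ _
    have hAK (j k : Fin 2) : |A j k - K j k| < min δ₁ δ₂ := by
      rw [hApair, hKdef, pairMatrix_apply, pairMatrix_apply]
      exact hθ (j, k)
    have hFA := h₁ A hApos fun j k ↦ (hAK j k).trans_le (min_le_left _ _)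
    have hF2A : |F2 A - F2 K| < 1 := h₂ A hApos fun j k ↦ (hAK j k).trans_le (min_le_right _ _)
    refine le_trans (measureReal_mono (fun l hl ↦ ?_) (by finiteness))
      ((measureReal_layer_average_le hφ hφ' (wVar Cw H (μ + 1)) (Cb (μ + 1)) (fanIn M H μ)
        a a' hH hηpos).trans (le_trans ?_ hH'))
    · simp only [Set.mem_ofPred_eq, condCov_succ_update, hker] at hl ⊢
      by_contra! hlt
      have h3 : |(∑ i ∈ Finset.range H, φ (affine (fanIn M H μ) (l i) a) *
          φ (affine (fanIn M H μ) (l i) a')) / H - F K| < 2 * η := by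
        calc _ ≤ _ := abs_sub_le _ (F A) _
          _ < η + η := add_lt_add hlt hFA
          _ = 2 * η := by ring
      rw [add_sub_add_right_eq_sub, ← mul_sub, abs_mul, abs_of_nonneg hCw] at hl
      linarith [mul_le_mul_of_nonneg_left h3.le hCw]
    · gcongr
      change F2 A ≤ F2 K + 1
      linarith [(le_abs_self _).trans hF2A.le]

/-! ### Characteristic functions of finitely many outputs -/

section CharFun

variable {M : ℕ} {φ : ℝ → ℝ} (Cw Cb : ℕ → ℝ≥0) {J : Type*}

lemma measurable_act_toLp (hφ : Continuous φ) (H μ : ℕ) (y : J → Fin M → ℝ) (i : J → ℕ) :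
    Measurable fun θ ↦ WithLp.toLp 2 fun j ↦ act φ H θ (y j) (μ + 1) (i j) :=
  (WithLp.measurable_toLp 2 _).comp
    (measurable_pi_lambda _ fun j ↦ measurable_act H hφ (y j) μ (i j))

lemma measurable_affine_toLp (n : ℕ) (a : J → ℕ → ℝ) (i : J → ℕ) :
    Measurable fun l : ℕ → ℕ → ℝ ↦ WithLp.toLp 2 fun j ↦ affine n (l (i j)) (a j) := by
  refine (WithLp.measurable_toLp 2 _).comp (measurable_pi_lambda _ fun j ↦ ?_)
  unfold affine
  fun_prop

variable [Fintype J]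

/-- The quadratic form of the covariance `δ_{i,i'} K(x, x')`, for the units `i j` and a family of
values `A j k`. -/
def unitForm (i : J → ℕ) (u : J → ℝ) (A : J × J → ℝ) : ℝ :=
  ∑ j, ∑ k, u j * u k * (if i j = i k then A (j, k) else 0)

lemma continuous_unitForm (i : J → ℕ) (u : J → ℝ) : Continuous (unitForm i u) := by
  unfold unitForm
  refine continuous_finsetSum _ fun j _ ↦ continuous_finsetSum _ fun k _ ↦ ?_
  split_ifs <;> fun_prop

lemma charFun_layerLaw_affine (w c : ℝ≥0) (n : ℕ) (a : J → ℕ → ℝ) (i : J → ℕ)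
    (u : EuclideanSpace ℝ J) :
    charFun ((layerLaw w c).map fun l ↦ WithLp.toLp 2 fun j ↦ affine n (l (i j)) (a j)) u =
      Complex.exp (-(unitForm i u fun p ↦ gram w c n (a p.1) (a p.2) : ℝ) / 2) := by
  rw [charFun_map_gaussianProcess (isGaussianProcess_affine w c n)
    (fun q ↦ integral_affine w c n q.1 q.2) fun j ↦ (i j, a j)]
  unfold unitForm
  congr 4
  refine Finset.sum_congr rfl fun j _ ↦ Finset.sum_congr rfl fun k _ ↦ ?_
  rw [covariance_affine w c n (i j, a j) (i k, a k)]

/-- Resampling layer `μ + 1` makes the inner integral the characteristic function of an exact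
Gaussian vector. -/
lemma charFun_act (hφ : Continuous φ) (H μ : ℕ) (y : J → Fin M → ℝ) (i : J → ℕ)
    (u : EuclideanSpace ℝ J) :
    charFun ((netLaw Cw Cb H).map
        fun θ ↦ WithLp.toLp 2 fun j ↦ act φ H θ (y j) (μ + 1) (i j)) u =
      ∫ θ, Complex.exp
        (-(unitForm i u fun p ↦ condCov φ Cw Cb H θ (y p.1) (y p.2) μ : ℝ) / 2)
        ∂netLaw Cw Cb H := by
  have hm := measurable_act_toLp hφ H μ y i
  rw [charFun_apply, integral_map hm.aemeasurable (by fun_prop)]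
  have hint : Integrable (fun θ ↦ Complex.exp (inner ℝ
      (WithLp.toLp 2 fun j ↦ act φ H θ (y j) (μ + 1) (i j)) u * Complex.I)) (netLaw Cw Cb H) := by
    refine Integrable.of_bound (C := 1) ?_ (.of_forall fun θ ↦ ?_)
    · exact (Continuous.measurable (by fun_prop : Continuous fun z : EuclideanSpace ℝ J ↦
        Complex.exp (inner ℝ z u * Complex.I)) |>.comp hm).aestronglyMeasurable
    · rw [Complex.norm_exp_ofReal_mul_I]
  have h := integral_infinitePi_update (fun μ ↦ layerLaw (wVar Cw H μ) (Cb μ)) (μ + 1) hint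
  refine h.trans (integral_congr_ae (.of_forall fun θ ↦ ?_))
  have hl := charFun_layerLaw_affine (wVar Cw H (μ + 1)) (Cb (μ + 1)) (fanIn M H μ)
    (fun j ↦ feat φ H θ (y j) μ) i u
  have hma := measurable_affine_toLp (fanIn M H μ) (fun j ↦ feat φ H θ (y j) μ) i
  rw [charFun_apply, integral_map hma.aemeasurable (by fun_prop)] at hl
  simp only [act_update]
  exact hl

/-- The characteristic functions of finitely many outputs converge. -/
lemma tendsto_charFun_act (hφ : Continuous φ) (hφ' : LinearEnvelope φ) (μ : ℕ)
    (y : J → Fin M → ℝ) (i : J → ℕ) (u : EuclideanSpace ℝ J) :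
    Tendsto (fun H ↦ charFun ((netLaw Cw Cb H).map
        fun θ ↦ WithLp.toLp 2 fun j ↦ act φ H θ (y j) (μ + 1) (i j)) u) atTop
      (nhds (Complex.exp
        (-(unitForm i u fun p ↦ kernel φ Cw Cb (μ + 1) (y p.1) (y p.2) : ℝ) / 2))) := by
  set f : (J × J → ℝ) → ℂ := fun A ↦ Complex.exp (-(unitForm i u A : ℝ) / 2) with hf
  have hfc : Continuous f := by have := continuous_unitForm i u; fun_prop
  set A : ℕ → (ℕ → ℕ → ℕ → ℝ) → J × J → ℝ :=
    fun H θ p ↦ condCov φ Cw Cb H θ (y p.1) (y p.2) μ with hA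
  set K : J × J → ℝ := fun p ↦ kernel φ Cw Cb (μ + 1) (y p.1) (y p.2)
  have hAm (H : ℕ) : Measurable (A H) :=
    measurable_pi_lambda _ fun p ↦ measurable_condCov H Cw Cb hφ _ _ _
  -- `f (A H θ)` is itself the characteristic function of a probability measure.
  have hnorm (H : ℕ) (θ : ℕ → ℕ → ℕ → ℝ) : ‖f (A H θ)‖ ≤ 1 := by
    have h := charFun_layerLaw_affine (wVar Cw H (μ + 1)) (Cb (μ + 1)) (fanIn M H μ)
      (fun j ↦ feat φ H θ (y j) μ) i u
    have hma := measurable_affine_toLp (fanIn M H μ) (fun j ↦ feat φ H θ (y j) μ) i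
    have := Measure.isProbabilityMeasure_map
      (μ := layerLaw (wVar Cw H (μ + 1)) (Cb (μ + 1))) hma.aemeasurable
    exact (congrArg norm h).symm.trans_le (norm_charFun_le_one u)
  have hchar (H : ℕ) := charFun_act Cw Cb hφ H μ y i u
  simp_rw [hchar]
  rw [tendsto_iff_norm_sub_tendsto_zero]
  have hlim := tendsto_integral_of_tendstoProb (ν := netLaw Cw Cb)
    (X := fun p H θ ↦ A H θ p) (c := K)
    (fun p H ↦ measurable_condCov H Cw Cb hφ _ _ _)
    (fun p ↦ tendstoProb_condCov Cw Cb hφ hφ' μ _ _)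
    (G := fun H θ ↦ ‖f (A H θ) - f K‖) (B := 1 + ‖f K‖)
    (fun H ↦ ((hfc.measurable.comp (hAm H)).sub_const _).norm) (fun _ _ ↦ norm_nonneg _)
    (fun H θ ↦ (norm_sub_le _ _).trans (by gcongr; exact hnorm H θ)) fun ε hε ↦ by
      obtain ⟨δ, hδ, h⟩ := Metric.continuousAt_iff.1 (hfc.continuousAt (x := K)) ε hε
      refine ⟨δ, hδ, .of_forall fun H θ hθ ↦ ?_⟩
      rw [← dist_eq_norm]
      refine (h ?_).le
      rw [dist_pi_lt_iff hδ]
      simpa [Real.dist_eq] using hθ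
  refine squeeze_zero (fun _ ↦ norm_nonneg _) (fun H ↦ ?_) hlim
  have hint : Integrable (fun θ ↦ f (A H θ)) (netLaw Cw Cb H) :=
    Integrable.of_bound (hfc.measurable.comp (hAm H)).aestronglyMeasurable 1
      (.of_forall (hnorm H))
  calc ‖(∫ θ, f (A H θ) ∂netLaw Cw Cb H) - f K‖
      = ‖∫ θ, (f (A H θ) - f K) ∂netLaw Cw Cb H‖ := by
        rw [integral_sub hint (integrable_const _)]; simp
    _ ≤ _ := norm_integral_le_integral_norm _

end CharFun

-- Existence of the limiting Gaussian process

universe u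

section FeatureVectors

open scoped InnerProductSpace ComplexOrder

/-- Every symmetric positive semidefinite function of two variables is a Gram matrix. -/
lemma exists_inner_eq {T : Type u} (K : T → T → ℝ) (hsymm : ∀ s t, K s t = K t s)
    (hK : ∀ u : T →₀ ℝ, 0 ≤ u.sum fun s a ↦ u.sum fun t b ↦ a * b * K s t) :
    ∃ (E : Type u) (_ : NormedAddCommGroup E) (_ : InnerProductSpace ℝ E) (v : T → E),
      ∀ s t, ⟪v s, v t⟫_ℝ = K s t := by
  -- Reproducing kernels here are operator-valued, so `K s t` becomes multiplication by a scalar.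
  let Km : Matrix T T (ℝ →L[ℝ] ℝ) := Matrix.of fun s t ↦ K s t • (1 : ℝ →L[ℝ] ℝ)
  have hKm : Km.PosSemidef := by
    refine ((RKHS.posSemidef_tfae (K := Km)).out 0 2).2 (And.intro ?_ fun u ↦ ?_)
    · ext s t
      simp [Km, hsymm s t]
    · refine (hK u).trans_eq ?_
      simp only [Km, Finsupp.sum]
      simp only [Matrix.of_apply, smul_apply, one_apply_eq_self, smul_eq_mul, RCLike.inner_apply,
        conj_trivial, RCLike.re_to_real]
      rw [Finset.sum_comm]
      exact Finset.sum_congr rfl fun s _ ↦ Finset.sum_congr rfl fun t _ ↦ by ring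
  have : Fact Km.PosSemidef := ⟨hKm⟩
  let v : T → RKHS.OfKernel Km := fun t ↦ RKHS.kerFun (RKHS.OfKernel Km) t (1 : ℝ)
  refine ⟨RKHS.OfKernel Km, inferInstance, inferInstance, v, fun s t ↦ ?_⟩
  rw [← RKHS.kernel_inner, RKHS.OfKernel.kernel_ofKernel]
  simp [Km, hsymm s t]

end FeatureVectors

section Existence

open InnerProductSpace
open scoped InnerProductSpace

/-- The right side has the form in `covariance_linComb`, with variances `‖gramSchmidt ℝ f k‖ ^ 2`.
Leaving the vectors unnormalised allows linear dependence: a zero vector is a zero variance. -/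
lemma inner_gramSchmidt_expansion {E : Type*} [NormedAddCommGroup E] [InnerProductSpace ℝ E]
    (f : ℕ → E) : ∃ c : ℕ → ℕ → ℝ, ∀ n m,
      ⟪f n, f m⟫_ℝ = ∑ k ∈ Finset.range (n + 1) ∩ Finset.range (m + 1),
        c n k * c m k * (‖gramSchmidt ℝ f k‖₊ ^ 2 : ℝ≥0) := by
  let c : ℕ → ℕ → ℝ := fun n k ↦
    if k = n then 1 else ⟪gramSchmidt ℝ f k, f n⟫_ℝ / ‖gramSchmidt ℝ f k‖ ^ 2
  have hexp (n : ℕ) : f n = ∑ k ∈ Finset.range (n + 1), c n k • gramSchmidt ℝ f k := by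
    rw [Finset.sum_range_succ, add_comm]
    conv_lhs => rw [gramSchmidt_def'' ℝ f n]
    congr 1
    · simp [c]
    · refine Finset.sum_congr (by ext; simp) fun k hk ↦ ?_
      have : k ≠ n := (Finset.mem_range.1 hk).ne
      simp [c, this]
  refine ⟨c, fun n m ↦ ?_⟩
  conv_lhs => rw [hexp n, hexp m]
  simp_rw [sum_inner, inner_sum, real_inner_smul_left, real_inner_smul_right]
  rw [← Finset.filter_mem_eq_inter, Finset.sum_filter]
  refine Finset.sum_congr rfl fun k _ ↦ ?_
  split_ifs with hk
  · rw [Finset.sum_eq_single k]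
    · rw [real_inner_self_eq_norm_sq]; simp; ring
    · intro l _ hl
      rw [gramSchmidt_orthogonal ℝ f hl.symm]; simp
    · exact fun h ↦ absurd hk h
  · refine Finset.sum_eq_zero fun l hl ↦ ?_
    rw [gramSchmidt_orthogonal ℝ f (by rintro rfl; exact hk hl)]; simp

/-- Existence of a centred Gaussian process on a countable index set with given covariance. -/
lemma exists_gaussianProcess {T : Type*} [Countable T] (K : T → T → ℝ)
    (hsymm : ∀ s t, K s t = K t s)
    (hK : ∀ u : T →₀ ℝ, 0 ≤ u.sum fun s a ↦ u.sum fun t b ↦ a * b * K s t) :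
    ∃ G : Measure (T → ℝ), IsProbabilityMeasure G ∧
      IsGaussianProcess (fun (s : T) (F : T → ℝ) ↦ F s) G ∧ (∀ s, ∫ F, F s ∂G = 0) ∧
      ∀ s t, cov[fun F ↦ F s, fun F ↦ F t; G] = K s t := by
  obtain ⟨E, _, _, v, hv⟩ := exists_inner_eq K hsymm hK
  have := Encodable.ofCountable T
  -- Gram–Schmidt needs a sequence; numbers encoding no index get the zero vector.
  let f : ℕ → E := fun n ↦ (Encodable.decode (α := T) n).elim 0 v
  have hf (t : T) : f (Encodable.encode t) = v t := by simp [f]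
  obtain ⟨c, hc⟩ := inner_gramSchmidt_expansion f
  let var : ℕ → ℝ≥0 := fun k ↦ ‖gramSchmidt ℝ f k‖₊ ^ 2
  let Q : Measure (ℕ → ℝ) := Measure.infinitePi fun k ↦ gaussianReal 0 (var k)
  have hind : iIndepFun (fun (k : ℕ) (z : ℕ → ℝ) ↦ z k) Q :=
    iIndepFun_infinitePi (X := fun _ x ↦ x) fun _ ↦ measurable_id
  have hlaw (k : ℕ) : HasLaw (fun z : ℕ → ℝ ↦ z k) (gaussianReal 0 (var k)) Q := by
    have h := measurePreserving_eval_infinitePi (fun k : ℕ ↦ gaussianReal 0 (var k)) k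
    exact ⟨h.measurable.aemeasurable, h.map_eq⟩
  let p : T → Finset ℕ × (ℕ → ℝ) :=
    fun t ↦ (Finset.range (Encodable.encode t + 1), c (Encodable.encode t))
  let Y : T → (ℕ → ℝ) → ℝ := fun t ↦ linComb (fun k z ↦ z k) (p t)
  have hY : IsGaussianProcess Y Q := (isGaussianProcess_linComb hind hlaw).comp_right p
  have hYm (t : T) : Measurable (Y t) := by
    simp only [Y]; unfold linComb; fun_prop
  have hm : Measurable fun z t ↦ Y t z := measurable_pi_lambda _ hYm
  refine ⟨Q.map fun z t ↦ Y t z, Measure.isProbabilityMeasure_map hm.aemeasurable,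
    ⟨fun I ↦ ⟨?_⟩⟩, fun s ↦ ?_, fun s t ↦ ?_⟩
  · rw [Measure.map_map (by fun_prop) hm]
    exact (hY.hasGaussianLaw I).isGaussian_map
  · rw [integral_map hm.aemeasurable (measurable_pi_apply s).aestronglyMeasurable]
    exact integral_linComb hlaw _
  · rw [covariance_map (measurable_pi_apply s).aestronglyMeasurable
      (measurable_pi_apply t).aestronglyMeasurable hm.aemeasurable]
    refine (covariance_linComb hind hlaw (p s) (p t)).trans ?_
    rw [← hv, ← hf s, ← hf t, hc]

end Existence

/-! ### From finite-dimensional to weak convergence -/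

section CountableProduct

open Topology

variable {T : Type*}

/-- The extension by zero of a function on a finite set. -/
noncomputable def extendZero (I : Finset T) (z : EuclideanSpace ℝ I) (t : T) : ℝ :=
  open scoped Classical in if h : t ∈ I then z ⟨t, h⟩ else 0

/-- The restriction to a finite set. -/
noncomputable def restrictLp (I : Finset T) (F : T → ℝ) : EuclideanSpace ℝ I :=
  WithLp.toLp 2 fun j : I ↦ F j

lemma continuous_extendZero (I : Finset T) : Continuous (extendZero I) := by
  refine continuous_pi fun t ↦ ?_
  unfold extendZero
  split_ifs <;> fun_prop

lemma measurable_restrictLp (I : Finset T) : Measurable (restrictLp I) :=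
  (WithLp.measurable_toLp 2 _).comp (measurable_pi_lambda _ fun _ ↦ measurable_pi_apply _)

lemma extendZero_restrictLp (I : Finset T) (F : T → ℝ) {t : T} (ht : t ∈ I) :
    extendZero I (restrictLp I F) t = F t := by
  simp [extendZero, restrictLp, ht]

/-- A uniformly continuous function on a product is determined by finitely many coordinates, up to
a small error. -/
lemma exists_finset_dist_le {f : (T → ℝ) → ℝ} (hf : UniformContinuous f) {ε : ℝ} (hε : 0 < ε) :
    ∃ I : Finset T, ∀ F F' : T → ℝ, (∀ t ∈ I, F t = F' t) → |f F - f F'| < ε := by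
  have h : {p : (T → ℝ) × (T → ℝ) | dist (f p.1) (f p.2) < ε} ∈ uniformity (T → ℝ) :=
    hf (Metric.dist_mem_uniformity hε)
  -- The product uniformity is an infimum of comaps, so an entourage constrains finitely many
  -- coordinates.
  rw [Pi.uniformity, Filter.mem_iInf] at h
  obtain ⟨I, hI, V, hV, hS⟩ := h
  refine ⟨hI.toFinset, fun F F' hFF' ↦ ?_⟩
  have hmem : (F, F') ∈ ⋂ i, V i := by
    refine Set.mem_iInter.2 fun i ↦ ?_
    obtain ⟨U, hU, hUV⟩ := Filter.mem_comap.1 (hV i)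
    apply hUV
    change (F i, F' i) ∈ U
    rw [hFF' i (by simp)]
    exact refl_mem_uniformity hU
  rw [← hS] at hmem
  exact hmem

/-- On a countable product of lines, convergence of the characteristic functions of the
finite-dimensional marginals implies weak convergence. -/
lemma tendsto_of_tendsto_charFun_restrict [Countable T] {ν : ℕ → ProbabilityMeasure (T → ℝ)}
    {G : ProbabilityMeasure (T → ℝ)}
    (h : ∀ (I : Finset T) (u : EuclideanSpace ℝ I), Tendsto
      (fun n ↦ charFun ((ν n : Measure (T → ℝ)).map (restrictLp I)) u) atTop
        (𝓝 (charFun ((G : Measure (T → ℝ)).map (restrictLp I)) u))) :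
    Tendsto ν atTop (𝓝 G) := by
  have := Encodable.ofCountable T
  -- Countability provides a metric structure, so bounded Lipschitz test functions suffice.
  let : PseudoEMetricSpace (T → ℝ) := PiCountable.pseudoEMetricSpace
  rw [tendsto_iff_forall_lipschitz_integral_tendsto]
  rintro f ⟨C, hC⟩ ⟨L, hL⟩
  have huc : UniformContinuous f := hL.uniformContinuous
  have hfm : Measurable f := huc.continuous.measurable
  have hfb (F : T → ℝ) : |f F| ≤ |f 0| + C := by
    have := hC F 0
    rw [Real.dist_eq] at this
    have h1 := abs_add_le (f 0) (f F - f 0)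
    rw [add_sub_cancel] at h1
    linarith
  have hfi (μ : ProbabilityMeasure (T → ℝ)) : Integrable f (μ : Measure (T → ℝ)) :=
    Integrable.of_bound hfm.aestronglyMeasurable (|f 0| + C) (.of_forall hfb)
  rw [Metric.tendsto_atTop']
  intro ε hε
  -- Three errors of `ε / 4` arise: truncation to `I` under `ν n` and under `G`, and convergence of
  -- the marginals on `I`.
  obtain ⟨I, hI⟩ := exists_finset_dist_le huc (by positivity : 0 < ε / 4)
  have hmr (μ : ProbabilityMeasure (T → ℝ)) :
      IsProbabilityMeasure ((μ : Measure (T → ℝ)).map (restrictLp I)) :=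
    Measure.isProbabilityMeasure_map (measurable_restrictLp I).aemeasurable
  have hlevy := ProbabilityMeasure.tendsto_of_tendsto_charFun
    (μ := fun n ↦ ⟨(ν n : Measure (T → ℝ)).map (restrictLp I), hmr _⟩)
    (μ₀ := ⟨(G : Measure (T → ℝ)).map (restrictLp I), hmr _⟩) (h I)
  have hcont : Continuous fun z ↦ f (extendZero I z) :=
    huc.continuous.comp (continuous_extendZero I)
  let g : BoundedContinuousFunction (EuclideanSpace ℝ I) ℝ :=
    BoundedContinuousFunction.ofNormedAddCommGroup (fun z ↦ f (extendZero I z)) hcont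
      (|f 0| + C) fun z ↦ hfb _
  have hg := ProbabilityMeasure.tendsto_iff_forall_integral_tendsto.1 hlevy g
  have happrox (μ : ProbabilityMeasure (T → ℝ)) :
      |∫ F, f F ∂(μ : Measure (T → ℝ)) -
        ∫ z, g z ∂((μ : Measure (T → ℝ)).map (restrictLp I))| ≤ ε / 4 := by
    rw [integral_map (measurable_restrictLp I).aemeasurable g.continuous.aestronglyMeasurable,
      ← integral_sub (hfi μ), ← Real.norm_eq_abs]
    · refine (norm_integral_le_of_norm_le_const
        (C := ε / 4) (.of_forall fun F ↦ ?_)).trans ?_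
      · exact (hI _ _ fun t ht ↦ (extendZero_restrictLp I F ht).symm).le
      · simp
    · exact Integrable.of_bound
        (g.continuous.measurable.comp (measurable_restrictLp I)).aestronglyMeasurable (|f 0| + C)
        (.of_forall fun F ↦ hfb _)
  obtain ⟨N, hN⟩ := Metric.tendsto_atTop'.1 hg (ε / 4) (by positivity)
  refine ⟨N, fun n hn ↦ ?_⟩
  have h1 := happrox (ν n)
  have h2 := happrox G
  have h3 := hN n hn
  simp only [ProbabilityMeasure.coe_mk, Real.dist_eq] at h3
  rw [Real.dist_eq]
  rw [abs_le] at h1 h2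
  rw [abs_lt] at h3 ⊢
  constructor <;> linarith [h1.1, h1.2, h2.1, h2.2, h3.1, h3.2]

end CountableProduct

/-! ### Transfer from arbitrary networks to the canonical one -/

section Transfer

variable {M L D : ℕ} {φ : ℝ → ℝ}

/-- The activations only depend on the parameters of the network. -/
lemma activation_congr (φ : ℝ → ℝ) {h : ℕ → ℕ} {W W' : ℕ → ℕ → ℕ → ℝ} {b b' : ℕ → ℕ → ℝ}
    (hW : ∀ p ∈ weightIndex M L D h, W p.1 p.2.1 p.2.2 = W' p.1 p.2.1 p.2.2)
    (hb : ∀ q ∈ biasIndex M L D h, b q.1 q.2 = b' q.1 q.2) (x : Fin M → ℝ) :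
    ∀ μ ≤ D, ∀ i < layerWidth M L D h (μ + 1),
      activation φ h W b x (μ + 1) i = activation φ h W' b' x (μ + 1) i := by
  intro μ
  induction μ with
  | zero =>
    intro _ i hi
    simp only [activation]
    rw [hb (1, i) ⟨le_rfl, by simp, hi⟩]
    congr 1
    refine Finset.sum_congr rfl fun j _ ↦ ?_
    rw [hW (1, i, j) ⟨le_rfl, by simp, hi, by simp [layerWidth]⟩]
  | succ μ ih =>
    intro hμ i hi
    simp only [activation]
    rw [hb (μ + 2, i) ⟨by simp, by simpa using hμ, hi⟩]
    congr 1
    refine Finset.sum_congr rfl fun j hj ↦ ?_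
    have hj' : j < layerWidth M L D h (μ + 1) := by
      simpa [layerWidth, hμ] using hj
    rw [hW (μ + 2, i, j) ⟨by simp, by simpa using hμ, hi, by simpa using hj'⟩,
      ih (by omega) j hj']

/-- The index of the parameters of a network. -/
abbrev ParamIndex (M L D : ℕ) (h : ℕ → ℕ) : Type := weightIndex M L D h ⊕ biasIndex M L D h

/-- The position of a parameter of a network among all parameters. -/
def paramPos {h : ℕ → ℕ} : ParamIndex M L D h → ℕ × ℕ × ℕ :=
  Sum.elim (fun p ↦ (p.1.1, p.1.2.1, p.1.2.2 + 1)) fun q ↦ (q.1.1, q.1.2, 0)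

lemma paramPos_injective {h : ℕ → ℕ} :
    Function.Injective (paramPos : ParamIndex M L D h → ℕ × ℕ × ℕ) := by
  rintro (⟨⟨a, b, c⟩, hp⟩ | ⟨⟨a, b⟩, hp⟩) (⟨⟨a', b', c'⟩, hp'⟩ | ⟨⟨a', b'⟩, hp'⟩) <;>
    simp [paramPos]

open scoped Classical in
/-- The extension by zero of the parameters of a network to all layers and units. -/
noncomputable def extendParam {h : ℕ → ℕ} (z : ParamIndex M L D h → ℝ) : ℕ → ℕ → ℕ → ℝ
  | μ, i, 0 => if hq : (μ, i) ∈ biasIndex M L D h then z (Sum.inr ⟨_, hq⟩) else 0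
  | μ, i, j + 1 => if hp : (μ, i, j) ∈ weightIndex M L D h then z (Sum.inl ⟨_, hp⟩) else 0

lemma measurable_extendParam {h : ℕ → ℕ} :
    Measurable (extendParam : (ParamIndex M L D h → ℝ) → ℕ → ℕ → ℕ → ℝ) := by
  refine measurable_pi_lambda _ fun μ ↦ measurable_pi_lambda _ fun i ↦
    measurable_pi_lambda _ fun j ↦ ?_
  cases j <;> simp only [extendParam] <;> split_ifs <;> fun_prop

variable (Cw Cb : ℕ → ℝ≥0)

lemma hasLaw_netLaw (H : ℕ) (t : ℕ × ℕ × ℕ) :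
    HasLaw (fun θ : ℕ → ℕ → ℕ → ℝ ↦ θ t.1 t.2.1 t.2.2)
      (gaussianReal 0 (if t.2.2 = 0 then Cb t.1 else wVar Cw H t.1)) (netLaw Cw Cb H) :=
  (hasLaw_layerLaw (wVar Cw H t.1) (Cb t.1) t.2).fun_comp
    (measurePreserving_eval_infinitePi (fun μ ↦ layerLaw (wVar Cw H μ) (Cb μ)) t.1).hasLaw

lemma iIndepFun_comp_measurePreserving {ι Ω Ω' : Type*} {mΩ : MeasurableSpace Ω}
    {mΩ' : MeasurableSpace Ω'} {P : Measure Ω} {P' : Measure Ω'} [IsProbabilityMeasure P]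
    [IsProbabilityMeasure P'] {X : ι → Ω' → ℝ} (hX : iIndepFun X P') (hm : ∀ i, Measurable (X i))
    {g : Ω → Ω'} (hg : MeasurePreserving g P P') : iIndepFun (fun i ω ↦ X i (g ω)) P := by
  have hmg (i : ι) : Measurable fun ω ↦ X i (g ω) := (hm i).comp hg.measurable
  rw [iIndepFun_iff_map_fun_eq_infinitePi_map hmg]
  rw [iIndepFun_iff_map_fun_eq_infinitePi_map hm, ← hg.map_eq,
    Measure.map_map (measurable_pi_lambda _ hm) hg.measurable] at hX
  refine hX.trans ?_
  congr with i : 1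
  rw [Measure.map_map (hm i) hg.measurable]
  rfl

lemma iIndepFun_netLaw (H : ℕ) :
    iIndepFun (fun (t : ℕ × ℕ × ℕ) (θ : ℕ → ℕ → ℕ → ℝ) ↦ θ t.1 t.2.1 t.2.2)
      (netLaw Cw Cb H) := by
  refine iIndepFun_uncurry' (X := fun (μ : ℕ) (p : ℕ × ℕ) (θ : ℕ → ℕ → ℕ → ℝ) ↦ θ μ p.1 p.2)
    (fun μ p ↦ by fun_prop) ?_ fun μ ↦ ?_
  · exact iIndepFun_infinitePi (P := fun μ ↦ layerLaw (wVar Cw H μ) (Cb μ))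
      (X := fun _ (l : ℕ → ℕ → ℝ) (p : ℕ × ℕ) ↦ l p.1 p.2) fun _ ↦ by fun_prop
  · exact iIndepFun_comp_measurePreserving (iIndepFun_layerLaw (wVar Cw H μ) (Cb μ))
      (fun p ↦ by fun_prop)
      (measurePreserving_eval_infinitePi (fun μ ↦ layerLaw (wVar Cw H μ) (Cb μ)) μ)

/-- The variances of the parameters of a network of width `H`. -/
noncomputable def paramVar (H : ℕ) (s : ParamIndex M L D fun _ ↦ H) : ℝ≥0 :=
  if (paramPos s).2.2 = 0 then Cb (paramPos s).1 else wVar Cw H (paramPos s).1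

lemma hasLaw_param_netLaw (H : ℕ) :
    HasLaw (fun (θ : ℕ → ℕ → ℕ → ℝ) (s : ParamIndex M L D fun _ ↦ H) ↦
        θ (paramPos s).1 (paramPos s).2.1 (paramPos s).2.2)
      (Measure.infinitePi fun s ↦ gaussianReal 0 (paramVar Cw Cb H s)) (netLaw Cw Cb H) :=
  iIndepFun.hasLaw_infinitePi (fun s ↦ hasLaw_netLaw Cw Cb H (paramPos s))
    ((iIndepFun_netLaw Cw Cb H).precomp paramPos_injective)
    (measurable_pi_lambda _ fun s ↦ by fun_prop).aemeasurable

variable {Ω : Type*} [MeasurableSpace Ω] {P : Measure Ω} {H : ℕ}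
  {W : Ω → ℕ → ℕ → ℕ → ℝ} {b : Ω → ℕ → ℕ → ℝ} {Cw Cb}

/-- The parameters of a network. -/
def netParam (W : Ω → ℕ → ℕ → ℕ → ℝ) (b : Ω → ℕ → ℕ → ℝ) (h : ℕ → ℕ) (ω : Ω) :
    ParamIndex M L D h → ℝ :=
  Sum.elim (fun p ↦ W ω p.1.1 p.1.2.1 p.1.2.2) fun q ↦ b ω q.1.1 q.1.2

lemma hasLaw_netParam (hnet : IsRandomNetwork P M L D (fun _ ↦ H) Cw Cb W b) :
    HasLaw (netParam W b fun _ ↦ H)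
      (Measure.infinitePi fun s : ParamIndex M L D fun _ ↦ H ↦
        gaussianReal 0 (paramVar Cw Cb H s)) P := by
  have hlaw (s : ParamIndex M L D fun _ ↦ H) : HasLaw (fun ω ↦ netParam W b (fun _ ↦ H) ω s)
      (gaussianReal 0 (paramVar Cw Cb H s)) P := by
    rcases s with ⟨p, hp⟩ | ⟨q, hq⟩
    · simpa [paramVar, paramPos, netParam] using hnet.weight_law p hp
    · simpa [paramVar, paramPos, netParam] using hnet.bias_law q hq
  refine iIndepFun.hasLaw_infinitePi hlaw ?_ (aemeasurable_pi_iff.2 fun s ↦ (hlaw s).aemeasurable)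
  convert hnet.indep using 1
  ext s ω
  rcases s with p | q <;> rfl

/-- In both models the output is the same measurable function `Φ` of the parameters belonging to the
network, and these have the same product law. Entries outside the network, possibly not even
measurable, play no role. -/
lemma hasLaw_output (hφ : Continuous φ) (hnet : IsRandomNetwork P M L D (fun _ ↦ H) Cw Cb W b)
    {ι : Type*} (x : ι → Fin M → ℝ) :
    HasLaw (fun ω (s : ι × Fin L) ↦ activation φ (fun _ ↦ H) (W ω) (b ω) (x s.1) (D + 1) s.2)
      ((netLaw Cw Cb H).map fun θ (s : ι × Fin L) ↦ act φ H θ (x s.1) (D + 1) s.2) P := by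
  let Φ : (ParamIndex M L D (fun _ ↦ H) → ℝ) → ι × Fin L → ℝ :=
    fun z s ↦ act φ H (extendParam z) (x s.1) (D + 1) s.2
  have hΦ : Measurable Φ := measurable_pi_lambda _ fun s ↦
    (measurable_act H hφ (x s.1) D s.2).comp measurable_extendParam
  have hw (s : ι × Fin L) : (s.2 : ℕ) < layerWidth M L D (fun _ ↦ H) (D + 1) := by
    simp [layerWidth]
  have h1 : (fun ω (s : ι × Fin L) ↦
      activation φ (fun _ ↦ H) (W ω) (b ω) (x s.1) (D + 1) s.2) =
      fun ω ↦ Φ (netParam W b (fun _ ↦ H) ω) := by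
    ext ω s
    refine activation_congr φ (fun p hp ↦ ?_) (fun q hq ↦ ?_) (x s.1) D le_rfl _ (hw s)
    · simp [extendParam, netParam, hp]
    · simp [extendParam, netParam, hq]
  have h2 : (fun (θ : ℕ → ℕ → ℕ → ℝ) (s : ι × Fin L) ↦ act φ H θ (x s.1) (D + 1) s.2) =
      fun θ ↦ Φ fun s ↦ θ (paramPos s).1 (paramPos s).2.1 (paramPos s).2.2 := by
    ext θ s
    refine activation_congr φ (fun p hp ↦ ?_) (fun q hq ↦ ?_) (x s.1) D le_rfl _ (hw s)
    · simp [extendParam, paramPos, hp]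
    · simp [extendParam, paramPos, hq]
  rw [h1, h2]
  have hlaw : HasLaw Φ ((Measure.infinitePi fun s : ParamIndex M L D fun _ ↦ H ↦
      gaussianReal 0 (paramVar Cw Cb H s)).map Φ)
      (Measure.infinitePi fun s : ParamIndex M L D fun _ ↦ H ↦
        gaussianReal 0 (paramVar Cw Cb H s)) := ⟨hΦ.aemeasurable, rfl⟩
  have hc := hlaw.fun_comp (hasLaw_param_netLaw (M := M) (L := L) (D := D) Cw Cb H)
  rw [hc.map_eq]
  exact hlaw.fun_comp (hasLaw_netParam hnet)

end Transfer

/-! ### The limiting covariance and the conclusion -/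

section Limit

variable {M L D : ℕ} {φ : ℝ → ℝ} (Cw Cb : ℕ → ℝ≥0) {ι : Type*}

/-- The covariance of the limiting Gaussian process. -/
noncomputable def limitCov (φ : ℝ → ℝ) (D : ℕ) (x : ι → Fin M → ℝ) (s t : ι × Fin L) : ℝ :=
  if s.2 = t.2 then kernel φ Cw Cb (D + 1) (x s.1) (x t.1) else 0

lemma limitCov_comm (hφ : Continuous φ) (hφ' : LinearEnvelope φ) (x : ι → Fin M → ℝ)
    (s t : ι × Fin L) : limitCov Cw Cb φ D x s t = limitCov Cw Cb φ D x t s := by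
  unfold limitCov
  rw [kernel_comm Cw Cb hφ D _ _ (tendstoProb_condCov Cw Cb hφ hφ' D)]
  simp only [eq_comm]

/-- The form splits over output units: it is the sum over `i` of the kernel form evaluated at the
part of `u` on unit `i`. -/
lemma sum_limitCov_nonneg (hφ : Continuous φ) (hφ' : LinearEnvelope φ) (x : ι → Fin M → ℝ)
    (u : ι × Fin L →₀ ℝ) :
    0 ≤ u.sum fun s a ↦ u.sum fun t b ↦ a * b * limitCov Cw Cb φ D x s t := by
  have h (i : Fin L) := sum_nonneg_of_tendstoProb Cw Cb hφ (J := u.support) (μ := D)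
    (y := fun s ↦ x s.1.1)
    (fun s t ↦ tendstoProb_condCov Cw Cb hφ hφ' D (x s.1.1) (x t.1.1))
    fun s ↦ if s.1.2 = i then u s else 0
  refine (Finset.sum_nonneg fun i (_ : i ∈ Finset.univ) ↦ h i).trans_eq ?_
  rw [Finsupp.sum, Finset.sum_comm, ← Finset.sum_coe_sort u.support]
  refine Finset.sum_congr rfl fun s _ ↦ ?_
  rw [Finsupp.sum, Finset.sum_comm, ← Finset.sum_coe_sort u.support]
  refine Finset.sum_congr rfl fun t _ ↦ ?_
  simp only [limitCov]
  rw [Finset.sum_eq_single s.1.2]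
  · by_cases hst : s.1.2 = t.1.2
    · simp [hst]
    · simp [hst, Ne.symm hst]
  · intro i _ hi
    simp [hi.symm]
  · simp

end Limit

end DeepNet

theorem corollary1 (M L D : ℕ) (φ : ℝ → ℝ) (hφ : Continuous φ) (hφ' : DeepNet.LinearEnvelope φ)
    (Cw Cb : ℕ → ℝ≥0)
    {Ω : ℕ → Type*} [∀ H, MeasurableSpace (Ω H)] (P : ∀ H, Measure (Ω H))
    [∀ H, IsProbabilityMeasure (P H)]
    (W : ∀ H, Ω H → ℕ → ℕ → ℕ → ℝ) (b : ∀ H, Ω H → ℕ → ℕ → ℝ)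
    (hnet : ∀ H, DeepNet.IsRandomNetwork (P H) M L D (fun _ => H) Cw Cb (W H) (b H))
    {ι : Type*} [Countable ι] (x : ι → Fin M → ℝ) :
    ∃ (G : Measure (ι × Fin L → ℝ)) (_ : IsProbabilityMeasure G),
      IsGaussianProcess (fun (s : ι × Fin L) (F : ι × Fin L → ℝ) => F s) G ∧
      (∀ s : ι × Fin L, ∫ F, F s ∂G = 0) ∧
      (∀ s t : ι × Fin L, cov[fun F => F s, fun F => F t; G] =
        if s.2 = t.2 then DeepNet.kernel φ Cw Cb (D + 1) (x s.1) (x t.1) else 0) ∧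
      TendstoInDistribution
        (fun (H : ℕ) (ω : Ω H) (s : ι × Fin L) =>
          DeepNet.activation φ (fun _ => H) (W H ω) (b H ω) (x s.1) (D + 1) s.2)
        atTop (fun F : ι × Fin L → ℝ => F) P G := by
  obtain ⟨G, hG, hgauss, hmean, hcov⟩ := DeepNet.exists_gaussianProcess
    (DeepNet.limitCov Cw Cb φ D x) (DeepNet.limitCov_comm (L := L) Cw Cb hφ hφ' x)
    (DeepNet.sum_limitCov_nonneg Cw Cb hφ hφ' x)
  have hlaw (H : ℕ) := DeepNet.hasLaw_output hφ (hnet H) x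
  refine ⟨G, hG, hgauss, hmean, hcov, ⟨fun H ↦ (hlaw H).aemeasurable, by fun_prop, ?_⟩⟩
  refine DeepNet.tendsto_of_tendsto_charFun_restrict fun I u ↦ ?_
  -- From here the spaces `Ω H` are gone and only canonical laws remain.
  simp only [ProbabilityMeasure.coe_mk, (hlaw _).map_eq, Measure.map_id']
  have hout (H : ℕ) : Measurable fun (θ : ℕ → ℕ → ℕ → ℝ) (s : ι × Fin L) ↦
      DeepNet.act φ H θ (x s.1) (D + 1) s.2 :=
    measurable_pi_lambda _ fun s ↦ DeepNet.measurable_act H hφ (x s.1) D s.2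
  have hmap (H : ℕ) := Measure.map_map (μ := DeepNet.netLaw Cw Cb H)
    (DeepNet.measurable_restrictLp I) (hout H)
  simp only [hmap]
  have hlim : charFun (G.map (DeepNet.restrictLp I)) u =
      Complex.exp (-(DeepNet.unitForm (fun j : I ↦ (j.1.2 : ℕ)) u fun p ↦
        DeepNet.kernel φ Cw Cb (D + 1) (x p.1.1.1) (x p.2.1.1) : ℝ) / 2) := by
    refine (DeepNet.charFun_map_gaussianProcess hgauss hmean (fun j : I ↦ j.1) u).trans ?_
    simp only [hcov, DeepNet.limitCov, DeepNet.unitForm, Fin.val_inj]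
  rw [hlim]
  exact DeepNet.tendsto_charFun_act Cw Cb hφ hφ' D (fun j : I ↦ x j.1.1)
    (fun j : I ↦ (j.1.2 : ℕ)) u
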